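/- Let $\mathrm{Sol}=\mathbb R^3$ with the Riemannian metric $e^{-2z}dx^2+e^{2z}dy^2+dz^2$, for which the left-invariant fields $X=e^z\partial_x$, $Y=e^{-z}\partial_y$, $Z=\partial_z$ are orthonormal. A unit speed geodesic of $\mathrm{Sol}$ is of type A if it is a line directed by one of the fields $\pm\frac{X+Y}{\sqrt2}$, $\pm\frac{X-Y}{\sqrt2}$; of type B if it is contained in a leaf of $\{dx=0\}$ or of $\{dy=0\}$; and of type C otherwise. A closed Sol manifold is a closed smooth 3-manifold $L$ diffeomorphic to a quotient $\Lambda\backslash\mathrm{Sol}$, where $\Lambda$ is a discrete group of isometries of $\mathrm{Sol}$ acting without fixed point; a Sol metric on $L$ is a smooth Riemannian metric for which $L$ is isometric to such a quotient. A closed geodesic of $L$ (of any period $T>0$, not necessarily the minimal one) is of type A, B or C if its lifts to $\mathrm{Sol}$ are. Let $\gamma$ be a type A geodesic of $\mathrm{Sol}$, let $n$ be the image of $\gamma'$ under $(X,Y)\mapsto(X,-Y)$, and let $\xi$ be the contact plane field of the unit tangent bundle of $\mathrm{Sol}$. In the coordinates $(x,y,z,\dot x,\dot y,\dot z)$ of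 $T\,\mathrm{Sol}=\mathbb R^3\times\mathbb R^3$, put $$h_1=(n,0),\quad h_2=(Z,n),\quad h_3=(Z,2n),\quad h_4=(n,-Z).$$ This is a symplectic basis of $\xi$ along $\gamma$, with $dp\wedge dq=dh_1\wedge dh_2+dh_3\wedge dh_4$. Let $\Psi(t)\in \mathrm{Sp}(4,\mathbb R)$, $\Psi(0)=I$, be the matrix in these bases of the linearized geodesic flow along $\gamma$, and let $\Psi'=A\Psi$. The Morse–Bott index of $\gamma$ over $[0,T]$ is the (Bott–)Conley–Zehnder index of $\Psi|_{[0,T]}$ in the trivialization $(h_1,\dots,h_4)$, that is, the Conley–Zehnder index on $[0,T]$ of the solution of $V'=(A+\delta J)V$, $V(0)=I$, for all sufficiently small $\delta>0$, where $J$ is the infinitesimal positive rotation $h_1\mapsto h_2\mapsto -h_1$, $h_3\mapsto h_4\mapsto -h_3$. (When $\gamma$ lifts a closed geodesic of period $T$ of a quotient of $\mathrm{Sol}$, the frame $(h_i)$ closes up after time $T$, except possibly for those geodesics, on quotients which are not torus bundles over the circle, that are closed up by an isometry reversing the direction of $Z$: the frame is then multiplied by $-1$, and the index is understood as that of the path $\Psi|_{[0,T]}$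 in the frame along the lift.) **Proposition.** Let $L$ be a closed Sol manifold and let $\Pi$ be a finite set of free homotopy classes of closed curves in $L$. Then there exists a Sol metric on $L$ such that: 1. no element of $\Pi$ is realized by a closed geodesic of type C; 2. every closed geodesic of type A of $L$ which belongs to a class of $\Pi$, of period $T$, has Morse–Bott index $1$ over $[0,T]$. -/

import Mathlib

open scoped Manifold ContDiff

noncomputable section

namespace SolGeometry

/-! ### The Riemannian manifold Sol -/

/-- The underlying smooth manifold `ℝ³` of Sol, with coordinates `x = p 0`, `y = p 1`, `z = p 2`.
The Euclidean inner product of this type plays no role: only its smooth structure is used, and the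
Riemannian metric of Sol is `solMetric` below. -/
abbrev Sol : Type := EuclideanSpace ℝ (Fin 3)

/-- The left-invariant vector field `X = e^z ∂/∂x`. -/
def fieldX (p : Sol) : Sol := !₂[Real.exp (p 2), 0, 0]

/-- The left-invariant vector field `Y = e^{-z} ∂/∂y`. -/
def fieldY (p : Sol) : Sol := !₂[0, Real.exp (-p 2), 0]

/-- The left-invariant vector field `Z = ∂/∂z`. -/
def fieldZ (_ : Sol) : Sol := !₂[0, 0, 1]

/-- The matrix of the Sol metric `e^{-2z} dx² + e^{2z} dy² + dz²`, for which `X, Y, Z` are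
orthonormal. -/
def solGram (p : Sol) : Matrix (Fin 3) (Fin 3) ℝ :=
  Matrix.diagonal ![Real.exp (-(2 * p 2)), Real.exp (2 * p 2), 1]

/-- The Riemannian metric of Sol at `p`. -/
def solMetric (p v w : Sol) : ℝ := ∑ i, ∑ j, solGram p i j * v i * w j

/-- Isometries of Sol: diffeomorphisms which preserve the Riemannian metric. -/
def IsSolIsometry (φ : Equiv.Perm Sol) : Prop :=
  ContDiff ℝ ∞ φ ∧ ContDiff ℝ ∞ φ.symm ∧
    ∀ p v w, solMetric (φ p) (fderiv ℝ φ p v) (fderiv ℝ φ p w) = solMetric p v w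

/-! ### Geodesics of Sol -/

/-- The partial derivative `∂_l g_{ij}` of the metric coefficients. -/
def gramPartial (p : Sol) (l i j : Fin 3) : ℝ :=
  fderiv ℝ (fun q : Sol => solGram q i j) p (EuclideanSpace.single l 1)

/-- The Christoffel symbols `Γ^k_{ij}` of the Levi-Civita connection of Sol. -/
def christoffel (p : Sol) (k i j : Fin 3) : ℝ :=
  ∑ l, (1 / 2) * (solGram p)⁻¹ k l *
    (gramPartial p i j l + gramPartial p j i l - gramPartial p l i j)

/-- The geodesic vector field on `T Sol = Sol × ℝ³`, that is
`(q, v) ↦ (v, - Γ_q(v, v))`. -/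
def geodesicField (w : Sol × Sol) : Sol × Sol :=
  (w.2, WithLp.toLp 2 fun k => -∑ i, ∑ j, christoffel w.1 k i j * w.2 i * w.2 j)

/-- The curve `(γ, γ')` in `T Sol`. -/
def tangentLift (γ : ℝ → Sol) (t : ℝ) : Sol × Sol := (γ t, deriv γ t)

/-- Geodesics of Sol parametrized by arc length. -/
def IsUnitGeodesic (γ : ℝ → Sol) : Prop :=
  (∀ t, HasDerivAt (tangentLift γ) (geodesicField (tangentLift γ t)) t) ∧
    ∀ t, solMetric (γ t) (deriv γ t) (deriv γ t) = 1

/-- Type `A`: lines directed by `± (X + Y)/√2` or `± (X - Y)/√2`. -/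
def IsTypeA (γ : ℝ → Sol) : Prop :=
  IsUnitGeodesic γ ∧ ∃ a b : ℝ, (a = 1 ∨ a = -1) ∧ (b = 1 ∨ b = -1) ∧
    ∀ t, deriv γ t = (Real.sqrt 2)⁻¹ • (a • fieldX (γ t) + b • fieldY (γ t))

/-- Type `B`: geodesics contained in a leaf of `{dy = 0}` or of `{dx = 0}`. -/
def IsTypeB (γ : ℝ → Sol) : Prop :=
  IsUnitGeodesic γ ∧ ((∀ t, γ t 1 = γ 0 1) ∨ (∀ t, γ t 0 = γ 0 0))

/-- Type `C`: all the other geodesics. -/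
def IsTypeC (γ : ℝ → Sol) : Prop :=
  IsUnitGeodesic γ ∧ ¬ IsTypeA γ ∧ ¬ IsTypeB γ

/-! ### Sol-manifolds and Sol-metrics -/

section Manifolds

variable {L : Type*} [TopologicalSpace L] [ChartedSpace (EuclideanSpace ℝ (Fin 3)) L]

/-- `Λ` is a discrete group of isometries of Sol acting without fixed point, and `π` is a smooth map
inducing a diffeomorphism from `Λ \ Sol` onto `L`. (For groups of isometries of Sol, discreteness
amounts to a properly discontinuous action.) -/
structure IsSolQuotient (Λ : Subgroup (Equiv.Perm Sol)) (π : Sol → L) : Prop where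
  isometry : ∀ l ∈ Λ, IsSolIsometry l
  discrete : ProperlyDiscontinuousSMul Λ Sol
  free : ∀ l ∈ Λ, ∀ p, l p = p → l = 1
  localDiffeo : IsLocalDiffeomorph (𝓡 3) (𝓡 3) ∞ π
  surjective : Function.Surjective π
  fibers : ∀ p q, π p = π q ↔ ∃ l ∈ Λ, l p = q

variable (L) in
/-- `L` is diffeomorphic to a quotient of Sol by a discrete group of isometries acting without fixed
point. -/
def IsSolManifold : Prop :=
  ∃ (Λ : Subgroup (Equiv.Perm Sol)) (π : Sol → L), IsSolQuotient Λ π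

variable [IsManifold (𝓡 3) ∞ L]

variable (L) in
/-- Smooth Riemannian metrics on `L`. -/
abbrev SmoothMetric : Type _ :=
  Bundle.ContMDiffRiemannianMetric (𝓡 3) ∞ (EuclideanSpace ℝ (Fin 3))
    (fun x : L => TangentSpace (𝓡 3) x)

/-- The Riemannian manifold `(L, g)` is the quotient of the Riemannian manifold Sol by the group
`Λ`, with projection `π`; in particular `g` is a Sol-metric. -/
def IsSolMetric (g : SmoothMetric L) (Λ : Subgroup (Equiv.Perm Sol)) (π : Sol → L) : Prop :=
  IsSolQuotient Λ π ∧
    ∀ (p : Sol) (v w : TangentSpace (𝓡 3) p),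
      g.inner (π p) (mfderiv (𝓡 3) (𝓡 3) π p v) (mfderiv (𝓡 3) (𝓡 3) π p w) = solMetric p v w

end Manifolds

/-! ### Closed curves and free homotopy classes -/

section Loops

variable {L : Type*} [TopologicalSpace L]

variable (L) in
/-- Homotopy classes of maps from the circle `ℝ/ℤ` to `L`. -/
abbrev HomotopyClass : Type _ :=
  Quotient (⟨ContinuousMap.Homotopic, ContinuousMap.Homotopic.equivalence⟩ :
    Setoid C(AddCircle (1 : ℝ), L))

/-- The curve `γ` is closed of (not necessarily minimal) period `T > 0`, and the closed curve
`γ : ℝ/Tℤ → L` belongs to the homotopy class `c`. -/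
def Realizes (γ : ℝ → L) (T : ℝ) (c : HomotopyClass L) : Prop :=
  0 < T ∧ ∃ f : C(AddCircle (1 : ℝ), L),
    (∀ s : ℝ, f (s : AddCircle (1 : ℝ)) = γ (T * s)) ∧
    (Quotient.mk _ f : HomotopyClass L) = c

end Loops

/-! ### The Conley-Zehnder index -/

section ConleyZehnder

variable {ι : Type*} [Fintype ι] [DecidableEq ι]

/-- Entrywise derivative of a path of matrices. -/
def matDeriv (Ψ : ℝ → Matrix (ι ⊕ ι) (ι ⊕ ι) ℝ) (t : ℝ) : Matrix (ι ⊕ ι) (ι ⊕ ι) ℝ :=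
  Matrix.of fun i j => deriv (fun s => Ψ s i j) t

/-- Continuously differentiable paths of symplectic matrices starting at the identity. The symplectic
form of `ℝ^{2n}` is `ω(v, w) = (J v) · w = ∑ dp_i ∧ dq_i`, where `p_i` are the first `n` coordinates and `q_i`
the last ones, so that `t ↦ exp (t J)` is a positive rotation. -/
def IsSymplecticPath (Ψ : ℝ → Matrix (ι ⊕ ι) (ι ⊕ ι) ℝ) : Prop :=
  (∀ i j, ContDiff ℝ 1 fun t => Ψ t i j) ∧ (∀ t, Ψ t ∈ Matrix.symplecticGroup ι ℝ) ∧ Ψ 0 = 1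

/-- The subspace `ker (Ψ(t) - 1)`. -/
def crossingSpace (Ψ : ℝ → Matrix (ι ⊕ ι) (ι ⊕ ι) ℝ) (t : ℝ) : Submodule ℝ (ι ⊕ ι → ℝ) :=
  LinearMap.ker (Matrix.toLin' (Ψ t - 1))

/-- The crossing form `v ↦ ω(v, Ψ'(t) v)` on `ker (Ψ(t) - 1)`. -/
def crossingForm (Ψ : ℝ → Matrix (ι ⊕ ι) (ι ⊕ ι) ℝ) (t : ℝ) :
    QuadraticForm ℝ (crossingSpace Ψ t) :=
  ((Matrix.J ι ℝ).transpose * matDeriv Ψ t).toQuadraticForm'.restrict (crossingSpace Ψ t)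

/-- The signature of the crossing form. -/
def crossingSignature (Ψ : ℝ → Matrix (ι ⊕ ι) (ι ⊕ ι) ℝ) (t : ℝ) : ℤ :=
  (sigPos (crossingForm Ψ t) : ℤ) - (sigNeg (crossingForm Ψ t) : ℤ)

/-- The crossing form at time `t` is nondegenerate. -/
def IsRegularCrossing (Ψ : ℝ → Matrix (ι ⊕ ι) (ι ⊕ ι) ℝ) (t : ℝ) : Prop :=
  ∀ v, (∀ w, QuadraticMap.polar (crossingForm Ψ t) v w = 0) → v = 0

/-- The Robbin-Salamon formula for the Conley-Zehnder index: on `[0, T]`, the path `Ψ` has only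
finitely many crossings, all regular, does not have the eigenvalue `1` at time `T`, and half the
signature at `0` plus the sum of the signatures at the crossings in `(0, T)` equals `k`. -/
def HasRegularIndex (Ψ : ℝ → Matrix (ι ⊕ ι) (ι ⊕ ι) ℝ) (T : ℝ) (k : ℤ) : Prop :=
  IsSymplecticPath Ψ ∧ crossingSpace Ψ T = ⊥ ∧
    (∀ t ∈ Set.Icc 0 T, IsRegularCrossing Ψ t) ∧
    ∃ F : Finset ℝ, (∀ t, t ∈ F ↔ t ∈ Set.Ioo 0 T ∧ crossingSpace Ψ t ≠ ⊥) ∧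
      2 * k = crossingSignature Ψ 0 + 2 * ∑ t ∈ F, crossingSignature Ψ t

/-- The Conley-Zehnder index of the path `Ψ` on `[0, T]`, with `1` not an eigenvalue of `Ψ(T)`, is
`k`: through symplectic paths starting at the identity and without eigenvalue `1` at time `T`, it is
homotopic to a path with regular crossings and index `k`. -/
def HasConleyZehnderIndex (Ψ : ℝ → Matrix (ι ⊕ ι) (ι ⊕ ι) ℝ) (T : ℝ) (k : ℤ) : Prop :=
  IsSymplecticPath Ψ ∧
    ∃ H : ℝ → ℝ → Matrix (ι ⊕ ι) (ι ⊕ ι) ℝ,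
      ContinuousOn (fun u : ℝ × ℝ => H u.1 u.2) (Set.Icc 0 1 ×ˢ Set.Icc 0 T) ∧
      (∀ s ∈ Set.Icc (0 : ℝ) 1, ∀ t ∈ Set.Icc 0 T, H s t ∈ Matrix.symplecticGroup ι ℝ) ∧
      (∀ s ∈ Set.Icc (0 : ℝ) 1, H s 0 = 1 ∧ crossingSpace (H s) T = ⊥) ∧
      (∀ t ∈ Set.Icc 0 T, H 0 t = Ψ t) ∧
      HasRegularIndex (H 1) T k

/-- The Bott version of the Conley-Zehnder index, for a symplectic path `Ψ` on `[0, T]` which may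
have the eigenvalue `1` at time `T`. If `Ψ' = A Ψ`, this is the Conley-Zehnder index of the solution
of `V' = (A + δ J) V`, `V(0) = 1`, for every small enough `δ > 0`. -/
def HasBottIndex (Ψ : ℝ → Matrix (ι ⊕ ι) (ι ⊕ ι) ℝ) (T : ℝ) (k : ℤ) : Prop :=
  IsSymplecticPath Ψ ∧
    ∃ δ₀ : ℝ, 0 < δ₀ ∧ ∀ δ ∈ Set.Ioo 0 δ₀, ∃ V : ℝ → Matrix (ι ⊕ ι) (ι ⊕ ι) ℝ,
      V 0 = 1 ∧ (∀ t, matDeriv V t = (matDeriv Ψ t * (Ψ t)⁻¹ + δ • Matrix.J ι ℝ) * V t) ∧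
      HasConleyZehnderIndex V T k

end ConleyZehnder

/-! ### Linearized geodesic flow along geodesics of type A -/

/-- The basis of the contact plane field `ξ` of the unit tangent bundle at a vector `v` of type `A`
based at `q`. For `v = (X + Y)/√2` put `n = (X - Y)/√2`, and in general let `n` be the image of `v`
under `Y ↦ -Y`. Writing `u` for the vector `(u, 0)` and `u̇` for `(0, u)` in
`T_{(q,v)} (T Sol) = ℝ³ × ℝ³`, the basis is `h₁ = n`, `h₂ = Z + ṅ`, `h₃ = Z + 2 ṅ`, `h₄ = n - Ż`.
It is symplectic: the canonical form `dp ∧ dq` is `dh₁ ∧ dh₂ + dh₃ ∧ dh₄`. The first coordinates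
`h₁, h₃` have indices `inl 0, inl 1`, their conjugates `h₂, h₄` have indices `inr 0, inr 1`. -/
def contactFrame (w : Sol × Sol) : Fin 2 ⊕ Fin 2 → Sol × Sol :=
  let n : Sol := !₂[w.2 0, -w.2 1, 0]
  let e : Sol := fieldZ w.1
  Sum.elim ![(n, 0), (e, (2 : ℝ) • n)] ![(e, n), (n, -e)]

/-- `W` is transported by the linearization of the geodesic flow along `γ`, that is, `W` solves the
variational equation of the geodesic vector field along `(γ, γ')`. -/
def IsFlowInvariant (γ : ℝ → Sol) (W : ℝ → Sol × Sol) : Prop :=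
  ∀ t, HasDerivAt W (fderiv ℝ geodesicField (tangentLift γ t) (W t)) t

/-- `Ψ(t)` is the matrix, in the bases `(h_i)` at times `0` and `t`, of the linearization on `ξ` of the
geodesic flow along the type `A` geodesic `γ`. -/
def IsLinearizedFlow (γ : ℝ → Sol) (Ψ : ℝ → Matrix (Fin 2 ⊕ Fin 2) (Fin 2 ⊕ Fin 2) ℝ) : Prop :=
  Ψ 0 = 1 ∧
    ∀ j, IsFlowInvariant γ fun t => ∑ i, Ψ t i j • contactFrame (tangentLift γ t) i

/-- The Morse-Bott index, over a period `T`, of a closed type `A` geodesic with lift `γ` to Sol: the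
Bott Conley-Zehnder index on `[0, T]`, in the trivialization `(h_i)` of `ξ` along `γ`, of the
linearized geodesic flow. -/
def HasMorseBottIndex (γ : ℝ → Sol) (T : ℝ) (k : ℤ) : Prop :=
  ∃ Ψ, IsLinearizedFlow γ Ψ ∧ HasBottIndex Ψ T k

end SolGeometry

end

open scoped Manifold ContDiff

noncomputable section

namespace SolGeometry

/-! ### Coverings and free homotopies -/

section Covering

variable {E X G : Type*} [TopologicalSpace E] [TopologicalSpace X] [Group G] [MulAction G E]
  {p : E → X}

/-! The dilation `(x, y, z) ↦ (r x, r y, z)` is not an isometry of Sol for general `r`, but it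
normalizes the isometry group: conjugation multiplies the translation parts by `r` and leaves
everything else unchanged. Conjugating the deck group by it yields a new Sol metric on the same
manifold, and a small `r` makes the chosen homotopy classes short in the horizontal directions.

A homotopy class determines a conjugacy class of deck transformations, by lifting homotopies to the
covering (`isConj_of_homotopic`). Every isometry preserves or reverses the direction of `Z`, so its
square preserves it; when this square is a horizontal translation by `(a, b)`, the number `|a b|`
depends only on the conjugacy class. It is therefore bounded on finitely many classes, and dilating
multiplies it by `r²`. These two facts about isometries rest on their classification
(`IsSolIsometry.isStraight_or_isSwap`), obtained from the Killing fields of Sol.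

In the other direction, closed geodesics of types A and C, traversed twice, are closed up by
horizontal translations, because both horizontal momenta are nonzero. For type C,
`IsTypeC.le_abs_mul` gives `|a b| ≥ 1/8`, so a bound of `1/16` excludes them. For type A with period
`T`, the doubled period gives `|a b| = 2 T²` (`IsTypeA.abs_mul_eq`), so the same bound forces `T ≤
1`.

It remains to compute the index for short type A geodesics. In the given frame the linearized flow
has constant coefficients and splits into a shear and a rotation of frequency `√2`. After adding
`δJ` the shear becomes hyperbolic, the rotation turns by less than a full turn up to time `1`, and
the only crossing is at time `0`, with signature `3 - 1 = 2`; the index is `1`. -/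

theorem exists_smul_eq_of_comp_eq (h : IsQuotientCoveringMap p G) {A : Type*} [TopologicalSpace A]
    [PreconnectedSpace A] [Nonempty A] {f g : A → E} (hf : Continuous f) (hg : Continuous g)
    (hfg : ∀ a, p (f a) = p (g a)) : ∃ c : G, ∀ a, g a = c • f a := by
  have := h.toContinuousConstSMul
  obtain ⟨a₀⟩ := ‹Nonempty A›
  obtain ⟨c, hc⟩ := h.apply_eq_iff_mem_orbit.1 (hfg a₀).symm
  refine ⟨c, fun a => ?_⟩
  have := h.isCoveringMap.eq_of_comp_eq (g₁ := g) (g₂ := fun a => c • f a) hg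
    (hf.const_smul c) (by ext a; simp [h.map_smul, hfg a]) a₀ hc.symm
  exact congrFun this a

/-- Lift the free homotopy to `unitInterval × ℝ`, starting from `γ₀`. This strip is connected, so a
single deck transformation realizes the shift by one period on all of it: it is `c₀` on the initial
edge, and a conjugate of `c₁` on the final edge, where the lift differs from `γ₁` by a deck
transformation. -/
theorem isConj_of_homotopic (h : IsQuotientCoveringMap p G) {γ₀ γ₁ : ℝ → E}
    (h₀ : Continuous γ₀) (h₁ : Continuous γ₁) {f₀ f₁ : C(AddCircle (1 : ℝ), X)}
    (hf : f₀.Homotopic f₁) (hf₀ : ∀ s : ℝ, f₀ s = p (γ₀ s)) (hf₁ : ∀ s : ℝ, f₁ s = p (γ₁ s))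
    {c₀ c₁ : G} (hc₀ : ∀ s, γ₀ (s + 1) = c₀ • γ₀ s) (hc₁ : ∀ s, γ₁ (s + 1) = c₁ • γ₁ s) :
    IsConj c₀ c₁ := by
  have := h.isCancelSMul
  obtain ⟨F⟩ := hf
  let H : C(unitInterval × ℝ, X) :=
    ⟨fun a => F (a.1, (a.2 : AddCircle (1 : ℝ))), F.continuous.comp
      (continuous_fst.prodMk ((AddCircle.continuous_mk' 1).comp continuous_snd))⟩
  have H0 : ∀ s, H (0, s) = p (γ₀ s) := fun s => by simp [H, hf₀]
  let K := h.isCoveringMap.liftHomotopy H ⟨γ₀, h₀⟩ H0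
  have hK : ∀ a, p (K a) = H a := fun a =>
    congrFun (h.isCoveringMap.liftHomotopy_lifts H ⟨γ₀, h₀⟩ H0) a
  have hK0 : ∀ s, K (0, s) = γ₀ s := fun s =>
    h.isCoveringMap.liftHomotopy_zero H ⟨γ₀, h₀⟩ H0 s
  obtain ⟨c, hc⟩ := exists_smul_eq_of_comp_eq h (f := K) (g := fun a => K (a.1, a.2 + 1))
    K.continuous (by fun_prop) (fun a => by simp [hK, H])
  obtain ⟨d, hd⟩ := exists_smul_eq_of_comp_eq h (f := fun s => K (1, s)) (g := γ₁)
    (by fun_prop) h₁ (fun s => by simp [hK, H, hf₁])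
  have e₀ : c = c₀ := by
    refine IsCancelSMul.right_cancel c c₀ (γ₀ 0) ?_
    rw [← hc₀, ← hK0, ← hK0, ← hc]
  have e₁ : d * c = c₁ * d := by
    refine IsCancelSMul.right_cancel _ _ (K (1, 0)) ?_
    rw [mul_smul, mul_smul, ← hd, ← hc₁, ← hc, hd]
  exact isConj_iff.2 ⟨d, by rw [← e₀, e₁, mul_inv_cancel_right]⟩

end Covering

/-! ### Deck transformations attached to a homotopy class -/

section Quotient

variable {L : Type*} [TopologicalSpace L] [ChartedSpace (EuclideanSpace ℝ (Fin 3)) L]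
  {Λ : Subgroup (Equiv.Perm Sol)} {π : Sol → L}

theorem IsSolQuotient.isQuotientCoveringMap (h : IsSolQuotient Λ π) :
    IsQuotientCoveringMap π Λ := by
  have := h.discrete
  have : ContinuousConstSMul Λ Sol := ⟨fun l => (h.isometry l l.2).1.continuous⟩
  have : IsCancelSMul Λ Sol := isCancelSMul_iff_eq_one_of_smul_eq.2
    fun l p hl => Subtype.ext (h.free l l.2 p hl)
  have hq : Topology.IsQuotientMap π :=
    h.localDiffeo.isOpenMap.isQuotientMap h.localDiffeo.contMDiff.continuous h.surjective
  refine hq.isQuotientCoveringMap_of_properlyDiscontinuousSMul (G := Λ) ?_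
  intro p q
  rw [eq_comm, h.fibers]
  exact ⟨fun ⟨l, hl, e⟩ => ⟨⟨l, hl⟩, e⟩, fun ⟨l, e⟩ => ⟨l, l.2, e⟩⟩

/-- `l` is a deck transformation which closes up a lift of a loop in the class `c`. -/
def IsDeckOf (Λ : Subgroup (Equiv.Perm Sol)) (π : Sol → L) (c : HomotopyClass L)
    (l : Equiv.Perm Sol) : Prop :=
  l ∈ Λ ∧ ∃ (γ : ℝ → Sol) (f : C(AddCircle (1 : ℝ), L)), Continuous γ ∧
    (∀ s : ℝ, f s = π (γ s)) ∧ (∀ s, γ (s + 1) = l (γ s)) ∧ (Quotient.mk _ f : HomotopyClass L) = c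

theorem IsSolQuotient.exists_conj_of_isDeckOf (h : IsSolQuotient Λ π) {c : HomotopyClass L}
    {l l' : Equiv.Perm Sol} (hl : IsDeckOf Λ π c l) (hl' : IsDeckOf Λ π c l') :
    ∃ d ∈ Λ, d * l * d⁻¹ = l' := by
  obtain ⟨hm, γ, f, hγ, hf, hs, rfl⟩ := hl
  obtain ⟨hm', γ', f', hγ', hf', hs', he⟩ := hl'
  have := isConj_of_homotopic h.isQuotientCoveringMap hγ hγ' (Quotient.exact he.symm) hf hf'
    (c₀ := ⟨l, hm⟩) (c₁ := ⟨l', hm'⟩) hs hs'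
  obtain ⟨d, hd⟩ := isConj_iff.1 this
  exact ⟨d, d.2, congrArg Subtype.val hd⟩

/-- After rescaling time, `γ` and its shift by `T` are two lifts of the same loop, hence differ by
one deck transformation. -/
theorem IsSolQuotient.exists_isDeckOf (h : IsSolQuotient Λ π) {c : HomotopyClass L} {γ : ℝ → Sol}
    {T : ℝ} (hγ : Continuous γ) (hc : Realizes (fun t => π (γ t)) T c) :
    ∃ l, IsDeckOf Λ π c l ∧ ∀ t, γ (t + T) = l (γ t) := by
  obtain ⟨hT, f, hf, hc⟩ := hc
  obtain ⟨l, hl⟩ := exists_smul_eq_of_comp_eq h.isQuotientCoveringMap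
    (f := fun s => γ (T * s)) (g := fun s => γ (T * (s + 1))) (by fun_prop) (by fun_prop)
    (fun s => by simpa using (hf s).symm.trans ((congrArg f (by simp)).trans (hf (s + 1))))
  refine ⟨l, ⟨l.2, fun s => γ (T * s), f, by fun_prop, hf, hl, hc⟩, fun t => ?_⟩
  have := hl (t / T)
  rw [show T * (t / T + 1) = t + T by field_simp, show T * (t / T) = t by field_simp] at this
  exact this

end Quotient

/-! ### Coordinate formulas -/

theorem solMetric_eq (p v w : Sol) : solMetric p v w =
    Real.exp (-(2 * p 2)) * v 0 * w 0 + Real.exp (2 * p 2) * v 1 * w 1 + v 2 * w 2 := by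
  simp [solMetric, solGram, Fin.sum_univ_three, Matrix.diagonal_apply]

theorem hasFDerivAt_coord (i : Fin 3) (p : Sol) :
    HasFDerivAt (fun q : Sol => q i) (EuclideanSpace.proj i : Sol →L[ℝ] ℝ) p :=
  (EuclideanSpace.proj i : Sol →L[ℝ] ℝ).hasFDerivAt

theorem gramPartial_of_ne (p : Sol) (l : Fin 3) {i j : Fin 3} (h : i ≠ j) :
    gramPartial p l i j = 0 := by
  simp [gramPartial, solGram, h]

theorem gramPartial_zero_zero (p : Sol) (l : Fin 3) :
    gramPartial p l 0 0 = if l = 2 then -2 * Real.exp (-(2 * p 2)) else 0 := by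
  have h : HasFDerivAt (fun q : Sol => Real.exp (-(2 * q 2))) _ p :=
    (((hasFDerivAt_coord 2 p).const_mul 2).neg).exp
  rw [gramPartial]
  change fderiv ℝ (fun q : Sol => Real.exp (-(2 * q 2))) p _ = _
  rw [h.fderiv]
  fin_cases l <;> simp
  ring

theorem gramPartial_one_one (p : Sol) (l : Fin 3) :
    gramPartial p l 1 1 = if l = 2 then 2 * Real.exp (2 * p 2) else 0 := by
  have h : HasFDerivAt (fun q : Sol => Real.exp (2 * q 2)) _ p :=
    ((hasFDerivAt_coord 2 p).const_mul 2).exp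
  rw [gramPartial]
  change fderiv ℝ (fun q : Sol => Real.exp (2 * q 2)) p _ = _
  rw [h.fderiv]
  fin_cases l <;> simp
  ring

theorem gramPartial_two_two (p : Sol) (l : Fin 3) : gramPartial p l 2 2 = 0 := by
  rw [gramPartial]
  change fderiv ℝ (fun q : Sol => (1 : ℝ)) p _ = _
  simp

theorem solGram_inv (p : Sol) : (solGram p)⁻¹ =
    Matrix.diagonal ![Real.exp (2 * p 2), Real.exp (-(2 * p 2)), 1] := by
  refine Matrix.inv_eq_left_inv ?_
  rw [solGram, Matrix.diagonal_mul_diagonal, ← Matrix.diagonal_one]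
  congr 1
  ext i
  fin_cases i <;> simp [← Real.exp_add]

theorem geodesicField_eq (w : Sol × Sol) : geodesicField w =
    (w.2, !₂[2 * w.2 2 * w.2 0, -(2 * w.2 2 * w.2 1),
      Real.exp (2 * w.1 2) * w.2 1 ^ 2 - Real.exp (-(2 * w.1 2)) * w.2 0 ^ 2]) := by
  have e1 : Real.exp (2 * w.1 2) * Real.exp (-(2 * w.1 2)) = 1 := by simp [← Real.exp_add]
  unfold geodesicField
  refine Prod.ext rfl ?_
  ext k
  fin_cases k <;>
    simp [christoffel, solGram_inv, gramPartial_of_ne, gramPartial_zero_zero, gramPartial_one_one,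
      gramPartial_two_two, Fin.sum_univ_three, Matrix.diagonal_apply]
  · linear_combination (2 * w.2 2 * w.2 0) * e1
  · linear_combination (-2 * w.2 2 * w.2 1) * e1
  · ring

/-! ### Killing fields of Sol -/

/-- The `i`-th partial derivative of a function on Sol. -/
def partialD (i : Fin 3) (f : Sol → ℝ) (p : Sol) : ℝ :=
  fderiv ℝ f p (EuclideanSpace.single i 1)

theorem contDiff_partialD {f : Sol → ℝ} (hf : ContDiff ℝ ∞ f) (i : Fin 3) :
    ContDiff ℝ ∞ (partialD i f) :=
  (hf.fderiv_right (m := ∞) (by exact_mod_cast le_top)).clm_apply contDiff_const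

theorem partialD_comm {f : Sol → ℝ} (hf : ContDiff ℝ ∞ f) (i j : Fin 3) :
    partialD i (partialD j f) = partialD j (partialD i f) := by
  have hd : Differentiable ℝ (fderiv ℝ f) :=
    (hf.fderiv_right (m := 1) (WithTop.coe_le_coe.2 le_top)).differentiable (by simp)
  have key : ∀ k l p, partialD k (partialD l f) p =
      fderiv ℝ (fderiv ℝ f) p (EuclideanSpace.single k 1) (EuclideanSpace.single l 1) := by
    intro k l p
    have := ((hd p).hasFDerivAt.clm_apply
      (hasFDerivAt_const (EuclideanSpace.single l (1 : ℝ)) p)).fderiv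
    rw [partialD, show partialD l f = fun q => fderiv ℝ f q (EuclideanSpace.single l 1) from rfl,
      this]
    simp
  ext p
  rw [key, key]
  exact (hf.contDiffAt.isSymmSndFDerivAt (by simpa using ENat.LEInfty.out)) _ _

theorem partialD_mul {f g : Sol → ℝ} (hf : ContDiff ℝ ∞ f) (hg : ContDiff ℝ ∞ g) (i : Fin 3)
    (p : Sol) : partialD i (fun q => f q * g q) p = partialD i f p * g p + f p * partialD i g p := by
  have := ((hf.differentiable (by simp) p).hasFDerivAt.mul
    (hg.differentiable (by simp) p).hasFDerivAt).fderiv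
  rw [partialD]
  change fderiv ℝ (f * g) p _ = _
  rw [this]
  simp [partialD]
  ring

theorem partialD_add {f g : Sol → ℝ} (hf : ContDiff ℝ ∞ f) (hg : ContDiff ℝ ∞ g) (i : Fin 3)
    (p : Sol) : partialD i (fun q => f q + g q) p = partialD i f p + partialD i g p := by
  have := ((hf.differentiable (by simp) p).hasFDerivAt.add
    (hg.differentiable (by simp) p).hasFDerivAt).fderiv
  rw [partialD]
  change fderiv ℝ (f + g) p _ = _
  rw [this]
  simp [partialD]

theorem partialD_neg (f : Sol → ℝ) (i : Fin 3) (p : Sol) :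
    partialD i (fun q => -f q) p = -partialD i f p := by
  simp [partialD, fderiv_fun_neg]

theorem contDiff_exp_coord (c : ℝ) : ContDiff ℝ ∞ fun q : Sol => Real.exp (c * q 2) := by
  fun_prop

theorem partialD_exp (c : ℝ) (i : Fin 3) (p : Sol) :
    partialD i (fun q => Real.exp (c * q 2)) p = if i = 2 then c * Real.exp (c * p 2) else 0 := by
  have h : HasFDerivAt (fun q : Sol => Real.exp (c * q 2)) _ p :=
    ((hasFDerivAt_coord 2 p).const_mul c).exp
  rw [partialD, h.fderiv]
  fin_cases i <;> simp
  ring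

theorem partialD_zero (i : Fin 3) (p : Sol) : partialD i (fun _ => 0) p = 0 := by
  simp [partialD]

theorem exists_affine_of_partialD {f : Sol → ℝ} (hf : ContDiff ℝ ∞ f) (c : Fin 3 → ℝ)
    (h : ∀ i p, partialD i f p = c i) :
    ∀ p, f p = f 0 + (c 0 * p 0 + c 1 * p 1 + c 2 * p 2) := by
  let A : Sol →L[ℝ] ℝ := c 0 • EuclideanSpace.proj 0 + c 1 • EuclideanSpace.proj 1 +
    c 2 • EuclideanSpace.proj 2
  have hd := hf.differentiable (by simp)
  have hz : ∀ p, fderiv ℝ (fun q => f q - A q) p = 0 := by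
    intro p
    rw [fderiv_fun_sub (hd p) A.differentiableAt, A.fderiv]
    refine ContinuousLinearMap.coe_injective ((EuclideanSpace.basisFun (Fin 3) ℝ).toBasis.ext ?_)
    intro i
    have := h i p
    rw [partialD] at this
    fin_cases i <;> simpa [A, sub_eq_zero] using this
  intro p
  have := is_const_of_fderiv_eq_zero (hd.sub A.differentiable) hz p 0
  simp [A] at this
  linarith

/-- The Killing equations for the field `(u, v, w)`, solved. -/
theorem killing_solution {u v w : Sol → ℝ} (hu : ContDiff ℝ ∞ u) (hv : ContDiff ℝ ∞ v)
    (hw : ContDiff ℝ ∞ w)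
    (h1 : ∀ p, partialD 0 u p = w p) (h2 : ∀ p, partialD 1 v p = -w p)
    (h3 : ∀ p, partialD 2 w p = 0)
    (h4 : ∀ p : Sol, Real.exp (-2 * p 2) * partialD 1 u p + Real.exp (2 * p 2) * partialD 0 v p = 0)
    (h5 : ∀ p : Sol, Real.exp (-2 * p 2) * partialD 2 u p + partialD 0 w p = 0)
    (h6 : ∀ p : Sol, Real.exp (2 * p 2) * partialD 2 v p + partialD 1 w p = 0) :
    ∃ α β γ : ℝ, ∀ p : Sol, u p = α + γ * p 0 ∧ v p = β - γ * p 1 ∧ w p = γ := by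
  have E : ∀ p : Sol, Real.exp (-2 * p 2) * Real.exp (2 * p 2) = 1 := fun p => by
    rw [← Real.exp_add]; simp
  have E1 : ∀ p : Sol, Real.exp (-2 * p 2) ≠ 0 := fun p => (Real.exp_pos _).ne'
  have E2 : ∀ p : Sol, Real.exp (2 * p 2) ≠ 0 := fun p => (Real.exp_pos _).ne'
  have f1 : partialD 0 u = w := funext h1
  have f2 : partialD 1 v = fun p => -w p := funext h2
  have f3 : partialD 2 w = fun _ => 0 := funext h3
  have cu := contDiff_partialD hu
  have cv := contDiff_partialD hv
  have cw := contDiff_partialD hw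
  have d5 : ∀ i p, partialD i (fun q : Sol => Real.exp (-2 * q 2) * partialD 2 u q + partialD 0 w q) p
      = 0 := fun i p => by rw [show (fun q : Sol => _) = fun _ => (0 : ℝ) from funext h5, partialD_zero]
  have d6 : ∀ i p, partialD i (fun q : Sol => Real.exp (2 * q 2) * partialD 2 v q + partialD 1 w q) p
      = 0 := fun i p => by rw [show (fun q : Sol => _) = fun _ => (0 : ℝ) from funext h6, partialD_zero]
  have d4 : ∀ i p, partialD i (fun q : Sol => Real.exp (-2 * q 2) * partialD 1 u q +
      Real.exp (2 * q 2) * partialD 0 v q) p = 0 := fun i p => by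
    rw [show (fun q : Sol => _) = fun _ => (0 : ℝ) from funext h4, partialD_zero]
  simp only [partialD_add ((contDiff_exp_coord (-2)).mul (cu 2)) (cw 0),
    partialD_mul (contDiff_exp_coord (-2)) (cu 2), partialD_exp] at d5
  simp only [partialD_add ((contDiff_exp_coord 2).mul (cv 2)) (cw 1),
    partialD_mul (contDiff_exp_coord 2) (cv 2), partialD_exp] at d6
  simp only [partialD_add ((contDiff_exp_coord (-2)).mul (cu 1)) ((contDiff_exp_coord 2).mul (cv 0)),
    partialD_mul (contDiff_exp_coord (-2)) (cu 1), partialD_mul (contDiff_exp_coord 2) (cv 0),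
    partialD_exp] at d4
  -- The `x`-derivative of `h5` contains `u_xz = w_z = 0`, so only `w_xx` survives; `w_yy` is
  -- treated in the same way with `h6`.
  have wxx : partialD 0 (partialD 0 w) = fun _ => 0 := by
    ext p
    have := d5 0 p
    rw [partialD_comm hu 0 2, f1, f3] at this
    simpa using this
  have wyy : partialD 1 (partialD 1 w) = fun _ => 0 := by
    ext p
    have := d6 1 p
    rw [partialD_comm hv 1 2, f2, partialD_neg, f3] at this
    simpa using this
  -- The mixed derivatives `u_yz` and `v_xz` are eliminated between the `z`-derivative of `h4`, the
  -- `y`-derivative of `h5` and the `x`-derivative of `h6`. Together with `h4` itself, this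
  -- expresses `u_y` through `w_xy`.
  have uy : partialD 1 u = fun p : Sol => -(1 / 2) *
      (Real.exp (2 * p 2) * partialD 1 (partialD 0 w) p) := by
    ext p
    have a := d4 2 p
    have b := d5 1 p
    have c := d6 0 p
    have e := h4 p
    rw [partialD_comm hu 1 2] at b
    rw [partialD_comm hv 0 2, partialD_comm hw 0 1] at c
    simp at a b c
    have : Real.exp (-2 * p 2) * (partialD 1 u p + (1 / 2) *
      (Real.exp (2 * p 2) * partialD 1 (partialD 0 w) p)) = 0 := by
      have e1 := E p
      simp only [neg_mul] at e1 e ⊢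
      linear_combination (-1/4) * a + (1/4) * b + (1/4) * c + (1/2) * e +
        1/2 * partialD 1 (partialD 0 w) p * e1
    have := (mul_eq_zero.1 this).resolve_left (E1 p)
    linarith
  have vx : partialD 0 v = fun p : Sol => (1 / 2) *
      (Real.exp (-2 * p 2) * partialD 0 (partialD 1 w) p) := by
    ext p
    have e := h4 p
    rw [uy] at e
    rw [partialD_comm hw 0 1]
    have : Real.exp (2 * p 2) * (partialD 0 v p - (1 / 2) *
      (Real.exp (-2 * p 2) * partialD 1 (partialD 0 w) p)) = 0 := by
      linear_combination e
    have := (mul_eq_zero.1 this).resolve_left (E2 p)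
    linarith
  have half : ∀ c : ℝ, ContDiff ℝ ∞ fun _ : Sol => c := fun c => contDiff_const
  have hc0 : ∀ (c : ℝ) i p, partialD i (fun _ => c) p = 0 := fun c i p => by simp [partialD]
  -- `u_xy` is `w_y` by `h1`, and also the `x`-derivative of the formula for `u_y`, which contains
  -- only `w_xxy = 0`.
  have wy : partialD 1 w = fun _ => 0 := by
    ext p
    have := congrFun (partialD_comm hu 1 0) p
    rw [f1, uy, partialD_mul (half _) ((contDiff_exp_coord 2).mul (contDiff_partialD (cw 0) 1)),
      partialD_mul (contDiff_exp_coord 2) (contDiff_partialD (cw 0) 1), partialD_exp,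
      partialD_comm (cw 0) 0 1, wxx, hc0, hc0] at this
    simpa using this
  have wx : partialD 0 w = fun _ => 0 := by
    ext p
    have := congrFun (partialD_comm hv 0 1) p
    rw [f2, vx, partialD_mul (half _) ((contDiff_exp_coord (-2)).mul (contDiff_partialD (cw 1) 0)),
      partialD_mul (contDiff_exp_coord (-2)) (contDiff_partialD (cw 1) 0), partialD_exp,
      partialD_comm (cw 1) 1 0, wyy, hc0, hc0, partialD_neg] at this
    simpa using this
  have wc := exists_affine_of_partialD hw (fun _ => 0) (fun i p => by
    fin_cases i
    · simp [wx]
    · simp [wy]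
    · simp [f3])
  have w0 : ∀ p, w p = w 0 := fun p => by simpa using wc p
  have uc := exists_affine_of_partialD hu ![w 0, 0, 0] (fun i p => by
    fin_cases i
    · simp [h1, w0 p]
    · simp [uy, wx, hc0]
    · have := h5 p
      simpa [wx] using this)
  have vc := exists_affine_of_partialD hv ![0, -w 0, 0] (fun i p => by
    fin_cases i
    · simp [vx, wy, hc0]
    · simp [h2, w0 p]
    · have := h6 p
      simpa [wy] using this)
  refine ⟨u 0, v 0, w 0, fun p => ⟨?_, ?_, w0 p⟩⟩
  · simpa using uc p
  · have := vc p
    simp at this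
    linarith

/-! ### Isometries of Sol -/

theorem IsSolIsometry.fderiv_symm_apply {φ : Equiv.Perm Sol} (h : IsSolIsometry φ) (p u : Sol) :
    fderiv ℝ φ p (fderiv ℝ φ.symm (φ p) u) = u := by
  have h1 := (h.1.differentiable (by simp) (φ.symm (φ p))).hasFDerivAt.comp (φ p)
    (h.2.1.differentiable (by simp) (φ p)).hasFDerivAt
  have h2 : HasFDerivAt (φ ∘ φ.symm) (ContinuousLinearMap.id ℝ Sol) (φ p) := by
    rw [φ.self_comp_symm]; exact hasFDerivAt_id _
  have := congrArg (fun A : Sol →L[ℝ] Sol => A u) (h1.unique h2)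
  simpa using this

/-- The image under an isometry of the Killing field `e`, where the metric does not depend on the
coordinate in the direction `e`, is a Killing field. -/
theorem IsSolIsometry.killing {φ : Equiv.Perm Sol} (h : IsSolIsometry φ) {e : Sol} (he : e 2 = 0)
    {W : Sol → Sol} (hWe : W = fun q => fderiv ℝ φ (φ.symm q) e) (q u : Sol) :
    -W q 2 * Real.exp (-(2 * q 2)) * u 0 ^ 2 + W q 2 * Real.exp (2 * q 2) * u 1 ^ 2 +
      solMetric q (fderiv ℝ W q u) u = 0 := by
  obtain ⟨p, rfl⟩ := φ.surjective q
  have hsm : ContDiff ℝ ∞ (fderiv ℝ φ) := h.1.fderiv_right (WithTop.coe_le_coe.2 le_top)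
  have hd : Differentiable ℝ (fderiv ℝ φ) := hsm.differentiable (by simp)
  obtain ⟨v, rfl⟩ : ∃ v, fderiv ℝ φ p v = u := ⟨_, h.fderiv_symm_apply p u⟩
  have hW : Differentiable ℝ W :=
    hWe ▸ ((hsm.comp h.2.1).clm_apply contDiff_const).differentiable (by simp)
  have hWp : W (φ p) = fderiv ℝ φ p e := by simp [hWe]
  -- the derivative of `W` along `dφ v` is the second derivative of `φ`
  have d1 : fderiv ℝ W (φ p) (fderiv ℝ φ p v) = fderiv ℝ (fderiv ℝ φ) p e v := by
    have a := (hW (φ p)).hasFDerivAt.comp p (h.1.differentiable (by simp) p).hasFDerivAt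
    have b := (hd p).hasFDerivAt.clm_apply (hasFDerivAt_const e p)
    have c : W ∘ φ = fun q => fderiv ℝ φ q e := by ext1 q; simp [hWe]
    rw [c] at a
    have := congrArg (fun A : Sol →L[ℝ] Sol => A v) (a.unique b)
    simp at this
    rw [this]
    exact (h.1.contDiffAt.isSymmSndFDerivAt (by simpa using ENat.LEInfty.out)) _ _
  -- differentiate the invariance of the metric along the line `p + s e`
  have hl : HasDerivAt (fun s : ℝ => p + s • e) e 0 := by
    simpa using ((hasDerivAt_id (0 : ℝ)).smul_const e).const_add p
  have hφ : HasDerivAt (fun s : ℝ => φ (p + s • e)) (fderiv ℝ φ p e) 0 := by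
    refine HasFDerivAt.comp_hasDerivAt (0 : ℝ) ?_ hl
    simpa using (h.1.differentiable (by simp) p).hasFDerivAt
  have hU : HasDerivAt (fun s : ℝ => fderiv ℝ φ (p + s • e) v)
      (fderiv ℝ (fderiv ℝ φ) p e v) 0 := by
    have : HasDerivAt (fun s : ℝ => fderiv ℝ φ (p + s • e)) (fderiv ℝ (fderiv ℝ φ) p e) 0 := by
      refine HasFDerivAt.comp_hasDerivAt (0 : ℝ) ?_ hl
      simpa using (hd p).hasFDerivAt
    simpa using this.clm_apply (hasDerivAt_const (0 : ℝ) v)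
  have coord : ∀ {f : ℝ → Sol} {f' : Sol}, HasDerivAt f f' 0 → ∀ i,
      HasDerivAt (fun s => f s i) (f' i) 0 := fun hf i =>
    (hasFDerivAt_coord i _).comp_hasDerivAt (0 : ℝ) hf
  have z := coord hφ 2
  have t := ((((z.const_mul 2).neg.exp.mul (coord hU 0)).mul (coord hU 0)).add
    (((z.const_mul 2).exp.mul (coord hU 1)).mul (coord hU 1))).add ((coord hU 2).mul (coord hU 2))
  have hconst : ∀ s : ℝ, Real.exp (-(2 * (φ (p + s • e)) 2)) * (fderiv ℝ φ (p + s • e) v) 0 *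
      (fderiv ℝ φ (p + s • e) v) 0 + Real.exp (2 * (φ (p + s • e)) 2) *
      (fderiv ℝ φ (p + s • e) v) 1 * (fderiv ℝ φ (p + s • e) v) 1 +
      (fderiv ℝ φ (p + s • e) v) 2 * (fderiv ℝ φ (p + s • e) v) 2 = solMetric p v v := by
    intro s
    have := h.2.2 (p + s • e) v v
    rw [solMetric_eq, solMetric_eq] at this
    rw [this, solMetric_eq]
    simp [he]
  have t0 := t.unique ((hasDerivAt_const (0 : ℝ) (solMetric p v v)).congr_of_eventuallyEq
    (Filter.Eventually.of_forall hconst))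
  rw [hWp, d1, solMetric_eq]
  simp at t0 ⊢
  linarith

/-- The image under an isometry of `∂/∂x` or `∂/∂y` is a multiple of `∂/∂x` or of `∂/∂y`. -/
theorem IsSolIsometry.exists_fderiv_eq {φ : Equiv.Perm Sol} (h : IsSolIsometry φ) {e : Sol}
    (he : e 2 = 0) (hinf : ∀ ε > 0, ∃ p, solMetric p e e < ε) :
    ∃ α β : ℝ, α * β = 0 ∧ ∀ p, fderiv ℝ φ p e = !₂[α, β, 0] := by
  have hsm : ContDiff ℝ ∞ (fderiv ℝ φ) := h.1.fderiv_right (WithTop.coe_le_coe.2 le_top)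
  obtain ⟨W, hWe⟩ : ∃ W : Sol → Sol, W = fun q => fderiv ℝ φ (φ.symm q) e := ⟨_, rfl⟩
  have K := h.killing he hWe
  have cW : ContDiff ℝ ∞ W := hWe ▸ (hsm.comp h.2.1).clm_apply contDiff_const
  have cWi : ∀ i, ContDiff ℝ ∞ fun q => W q i := fun i =>
    (EuclideanSpace.proj i : Sol →L[ℝ] ℝ).contDiff.comp cW
  have hp : ∀ i j q, partialD j (fun q => W q i) q =
      fderiv ℝ W q (EuclideanSpace.single j 1) i := by
    intro i j q
    have := ((hasFDerivAt_coord i (W q)).comp q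
      (cW.differentiable (by simp) q).hasFDerivAt).fderiv
    rw [partialD]
    change fderiv ℝ ((fun q : Sol => q i) ∘ W) q _ = _
    rw [this]
    rfl
  have E0 : ∀ q : Sol, Real.exp (-(2 * q 2)) ≠ 0 := fun q => (Real.exp_pos _).ne'
  have E1 : ∀ q : Sol, Real.exp (2 * q 2) ≠ 0 := fun q => (Real.exp_pos _).ne'
  simp only [solMetric_eq] at K
  have k0 : ∀ q, partialD 0 (fun q => W q 0) q = W q 2 := by
    intro q
    have := K q (EuclideanSpace.single 0 1)
    rw [hp]
    simp at this
    exact mul_left_cancel₀ (E0 q) (by linarith)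
  have k1 : ∀ q, partialD 1 (fun q => W q 1) q = -W q 2 := by
    intro q
    have := K q (EuclideanSpace.single 1 1)
    rw [hp]
    simp at this
    exact mul_left_cancel₀ (E1 q) (by linarith)
  have k2 : ∀ q, partialD 2 (fun q => W q 2) q = 0 := by
    intro q
    have := K q (EuclideanSpace.single 2 1)
    rw [hp]
    simpa using this
  have k01 := fun q => K q (EuclideanSpace.single 0 1 + EuclideanSpace.single 1 1)
  have k02 := fun q => K q (EuclideanSpace.single 0 1 + EuclideanSpace.single 2 1)
  have k12 := fun q => K q (EuclideanSpace.single 1 1 + EuclideanSpace.single 2 1)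
  simp [← hp, k0, k1, k2] at k01 k02 k12
  obtain ⟨α, β, γ, hs⟩ := killing_solution (cWi 0) (cWi 1) (cWi 2) k0 k1 k2
    (fun q => by rw [neg_mul]; linarith [k01 q]) (fun q => by rw [neg_mul]; linarith [k02 q])
    (fun q => by linarith [k12 q])
  have hn : ∀ p, Real.exp (-(2 * φ p 2)) * (α + γ * φ p 0) ^ 2 +
      Real.exp (2 * φ p 2) * (β - γ * φ p 1) ^ 2 + γ ^ 2 = solMetric p e e := by
    intro p
    rw [← h.2.2 p e e, solMetric_eq]
    have : fderiv ℝ φ p e = W (φ p) := by simp [hWe]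
    obtain ⟨a, b, c⟩ := hs (φ p)
    rw [this, a, b, c]
    ring
  -- The image field has length at least `|γ|` everywhere, whereas the length of `e` is arbitrarily
  -- small.
  have hγ : γ = 0 := by
    by_contra hγ
    obtain ⟨p, hlt⟩ := hinf (γ ^ 2) (by positivity)
    rw [← hn p] at hlt
    have : 0 ≤ Real.exp (-(2 * φ p 2)) * (α + γ * φ p 0) ^ 2 +
      Real.exp (2 * φ p 2) * (β - γ * φ p 1) ^ 2 := by positivity
    linarith
  subst hγ
  refine ⟨α, β, ?_, fun p => ?_⟩
  -- By the arithmetic-geometric mean inequality the squared length `e^{-2z} α² + e^{2z} β²` is at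
  -- least `2 |α β|`, which again contradicts arbitrarily small lengths.
  · by_contra hab
    obtain ⟨p, hlt⟩ := hinf (2 * |α * β|) (by positivity)
    rw [← hn p] at hlt
    have e2 : ∀ x : ℝ, Real.exp (2 * x) = Real.exp x ^ 2 := fun x => by
      rw [← Real.exp_nat_mul]; norm_num
    have e1 : Real.exp (-φ p 2) * Real.exp (φ p 2) = 1 := by rw [← Real.exp_add]; simp
    rw [← mul_neg, e2, e2] at hlt
    set A := Real.exp (-φ p 2)
    set B := Real.exp (φ p 2)
    have h1 : |α * β| = |A * α| * |B * β| := by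
      rw [← abs_mul, show A * α * (B * β) = A * B * (α * β) by ring, e1, one_mul]
    have h2 := two_mul_le_add_sq |A * α| |B * β|
    rw [sq_abs, sq_abs] at h2
    nlinarith
  · have : fderiv ℝ φ p e = W (φ p) := by simp [hWe]
    obtain ⟨a, b, c⟩ := hs (φ p)
    rw [this]
    ext i
    fin_cases i <;> simp [a, b, c]

/-- Isometries of Sol which preserve the direction of `Z`. -/
def IsStraight (φ : Sol → Sol) : Prop :=
  ∃ α β c a b : ℝ, α ^ 2 = Real.exp (2 * c) ∧ β ^ 2 = Real.exp (-(2 * c)) ∧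
    ∀ p, φ p = !₂[α * p 0 + a, β * p 1 + b, p 2 + c]

/-- Isometries of Sol which reverse the direction of `Z`. -/
def IsSwap (φ : Sol → Sol) : Prop :=
  ∃ α β c a b : ℝ, α ^ 2 = Real.exp (2 * c) ∧ β ^ 2 = Real.exp (-(2 * c)) ∧
    ∀ p, φ p = !₂[α * p 1 + a, β * p 0 + b, -p 2 + c]

theorem eq_of_partialD_eq {f g : Sol → ℝ} (hf : ContDiff ℝ ∞ f) (c : Fin 3 → ℝ)
    (h : ∀ i p, partialD i f p = c i) (hg : ∀ p, g p = c 0 * p 0 + c 1 * p 1 + c 2 * p 2 + f 0) :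
    f = g := by
  ext p
  rw [exists_affine_of_partialD hf c h, hg]
  ring

/-- The fields `∂/∂x` and `∂/∂y` have arbitrarily small length, so each goes to a constant multiple
of one of them; orthogonality makes the two images lie in different directions. Comparing the length
of `∂/∂x` with that of its image determines the `z`-coordinate of `φ` as `±z` plus a constant, and
orthogonality removes the horizontal part of the image of `∂/∂z`. -/
theorem IsSolIsometry.isStraight_or_isSwap {φ : Equiv.Perm Sol} (h : IsSolIsometry φ) :
    IsStraight φ ∨ IsSwap φ := by
  have hexp : ∀ ε > 0, ∃ z : ℝ, Real.exp z < ε := fun ε hε =>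
    ⟨Real.log (ε / 2), by rw [Real.exp_log (by positivity)]; linarith⟩
  obtain ⟨α₀, β₀, z₀, hD₀⟩ := h.exists_fderiv_eq (e := EuclideanSpace.single 0 1) (by simp) (by
    intro ε hε
    obtain ⟨z, hz⟩ := hexp ε hε
    refine ⟨!₂[0, 0, -z / 2], ?_⟩
    rw [solMetric_eq]
    simpa [neg_div, mul_div_cancel₀] using hz)
  obtain ⟨α₁, β₁, z₁, hD₁⟩ := h.exists_fderiv_eq (e := EuclideanSpace.single 1 1) (by simp) (by
    intro ε hε
    obtain ⟨z, hz⟩ := hexp ε hε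
    refine ⟨!₂[0, 0, z / 2], ?_⟩
    rw [solMetric_eq]
    simpa [mul_div_cancel₀] using hz)
  have cφ : ∀ i, ContDiff ℝ ∞ fun q => φ q i := fun i =>
    (EuclideanSpace.proj i : Sol →L[ℝ] ℝ).contDiff.comp h.1
  have hp : ∀ i j q, partialD j (fun q => φ q i) q =
      fderiv ℝ φ q (EuclideanSpace.single j 1) i := by
    intro i j q
    have := ((hasFDerivAt_coord i (φ q)).comp q
      (h.1.differentiable (by simp) q).hasFDerivAt).fderiv
    rw [partialD]
    change fderiv ℝ ((fun q : Sol => q i) ∘ φ) q _ = _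
    rw [this]
    rfl
  have m00 := fun p => h.2.2 p (EuclideanSpace.single 0 1) (EuclideanSpace.single 0 1)
  have m01 := fun p => h.2.2 p (EuclideanSpace.single 0 1) (EuclideanSpace.single 1 1)
  have m11 := fun p => h.2.2 p (EuclideanSpace.single 1 1) (EuclideanSpace.single 1 1)
  have m02 := fun p => h.2.2 p (EuclideanSpace.single 0 1) (EuclideanSpace.single 2 1)
  have m12 := fun p => h.2.2 p (EuclideanSpace.single 1 1) (EuclideanSpace.single 2 1)
  simp [solMetric_eq, hD₀, hD₁] at m00 m01 m11 m02 m12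
  have hlog : ∀ x : ℝ, x ≠ 0 → Real.exp (2 * Real.log |x|) = x ^ 2 := fun x hx => by
    rw [mul_comm, Real.exp_mul, Real.exp_log (abs_pos.2 hx)]
    norm_num
  rcases mul_eq_zero.1 z₀ with rfl | rfl
  · -- `∂/∂x` goes to a multiple of `∂/∂y`
    have hβ : β₀ ≠ 0 := by rintro rfl; simpa using m00 0
    have hβ₁ : β₁ = 0 := by simpa [hβ] using m01 0
    subst hβ₁
    have hα : α₁ ≠ 0 := by rintro rfl; simpa using m11 0
    simp at m00 m11
    simp [hα, hβ] at m02 m12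
    have hz : ∀ p : Sol, φ p 2 = -p 2 + -Real.log |β₀| := by
      intro p
      have := m00 p
      have h2 : Real.exp (2 * φ p 2 + 2 * Real.log |β₀|) = Real.exp (-(2 * p 2)) := by
        rw [Real.exp_add, hlog _ hβ, ← this]; ring
      linarith [Real.exp_injective h2]
    right
    refine ⟨α₁, β₀, -Real.log |β₀|, φ 0 0, φ 0 1, ?_, ?_, ?_⟩
    · have := m11 0
      rw [hz 0] at this
      simp [-Real.log_abs] at this
      rw [mul_neg, Real.exp_neg]
      exact eq_inv_of_mul_eq_one_left (by linarith)
    · rw [mul_neg, neg_neg, hlog _ hβ]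
    · have a0 := eq_of_partialD_eq (g := fun p => α₁ * p 1 + φ 0 0) (cφ 0) ![0, α₁, 0]
        (fun i p => by rw [hp]; fin_cases i <;> simp [hD₀, hD₁, m12]) (fun p => by simp)
      have a1 := eq_of_partialD_eq (g := fun p => β₀ * p 0 + φ 0 1) (cφ 1) ![β₀, 0, 0]
        (fun i p => by rw [hp]; fin_cases i <;> simp [hD₀, hD₁, m02]) (fun p => by simp)
      intro p
      ext i
      fin_cases i
      · simpa using congrFun a0 p
      · simpa using congrFun a1 p
      · simpa using hz p
  · have hα : α₀ ≠ 0 := by rintro rfl; simpa using m00 0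
    have hα₁ : α₁ = 0 := by simpa [hα] using m01 0
    subst hα₁
    have hβ : β₁ ≠ 0 := by rintro rfl; simpa using m11 0
    simp at m00 m11
    simp [hα, hβ] at m02 m12
    have hz : ∀ p : Sol, φ p 2 = p 2 + Real.log |α₀| := by
      intro p
      have := m00 p
      have h2 : Real.exp (-(2 * φ p 2) + 2 * Real.log |α₀|) = Real.exp (-(2 * p 2)) := by
        rw [Real.exp_add, hlog _ hα, ← this]; ring
      linarith [Real.exp_injective h2]
    left
    refine ⟨α₀, β₁, Real.log |α₀|, φ 0 0, φ 0 1, ?_, ?_, ?_⟩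
    · rw [hlog _ hα]
    · have := m11 0
      rw [hz 0] at this
      simp [-Real.log_abs] at this
      rw [Real.exp_neg]
      exact eq_inv_of_mul_eq_one_left (by linarith)
    · have a0 := eq_of_partialD_eq (g := fun p => α₀ * p 0 + φ 0 0) (cφ 0) ![α₀, 0, 0]
        (fun i p => by rw [hp]; fin_cases i <;> simp [hD₀, hD₁, m02]) (fun p => by simp)
      have a1 := eq_of_partialD_eq (g := fun p => β₁ * p 1 + φ 0 1) (cφ 1) ![0, β₁, 0]
        (fun i p => by rw [hp]; fin_cases i <;> simp [hD₀, hD₁, m12]) (fun p => by simp)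
      intro p
      ext i
      fin_cases i
      · simpa using congrFun a0 p
      · simpa using congrFun a1 p
      · simpa using hz p

/-! ### The two normal forms are isometries, and their conjugates by dilations -/

theorem contDiff_of_coord {φ : Sol → Sol} (h : ∀ i, ContDiff ℝ ∞ fun p => φ p i) :
    ContDiff ℝ ∞ φ :=
  contDiff_euclidean.2 h

theorem IsStraight.contDiff {φ : Sol → Sol} (h : IsStraight φ) : ContDiff ℝ ∞ φ := by
  obtain ⟨α, β, c, a, b, -, -, h⟩ := h
  refine contDiff_of_coord fun i => ?_
  simp only [h]
  fin_cases i <;> simp <;> fun_prop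

theorem IsSwap.contDiff {φ : Sol → Sol} (h : IsSwap φ) : ContDiff ℝ ∞ φ := by
  obtain ⟨α, β, c, a, b, -, -, h⟩ := h
  refine contDiff_of_coord fun i => ?_
  simp only [h]
  fin_cases i <;> simp <;> fun_prop

theorem fderiv_apply_coord {φ : Sol → Sol} {p : Sol} (h : DifferentiableAt ℝ φ p) (v : Sol)
    (i : Fin 3) : fderiv ℝ φ p v i = fderiv ℝ (fun q => φ q i) p v := by
  have := ((hasFDerivAt_coord i (φ p)).comp p h.hasFDerivAt).fderiv
  change _ = fderiv ℝ ((fun q : Sol => q i) ∘ φ) p v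
  rw [this]
  rfl

theorem IsStraight.solMetric_fderiv {φ : Sol → Sol} (h : IsStraight φ) (p v w : Sol) :
    solMetric (φ p) (fderiv ℝ φ p v) (fderiv ℝ φ p w) = solMetric p v w := by
  have hd := h.contDiff.differentiable (by simp) p
  obtain ⟨α, β, c, a, b, hα, hβ, h⟩ := h
  have k := fun i => fderiv_apply_coord hd v i
  have k' := fun i => fderiv_apply_coord hd w i
  have d0 : HasFDerivAt (fun q : Sol => φ q 0) (α • (EuclideanSpace.proj 0 : Sol →L[ℝ] ℝ)) p := by
    simpa [h] using ((hasFDerivAt_coord 0 p).const_mul α).add_const a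
  have d1 : HasFDerivAt (fun q : Sol => φ q 1) (β • (EuclideanSpace.proj 1 : Sol →L[ℝ] ℝ)) p := by
    simpa [h] using ((hasFDerivAt_coord 1 p).const_mul β).add_const b
  have d2 : HasFDerivAt (fun q : Sol => φ q 2) (EuclideanSpace.proj 2 : Sol →L[ℝ] ℝ) p := by
    simpa [h] using (hasFDerivAt_coord 2 p).add_const c
  rw [solMetric_eq, solMetric_eq, k, k, k, k', k', k', d0.fderiv, d1.fderiv, d2.fderiv]
  have e0 : Real.exp (-(2 * φ p 2)) * α ^ 2 = Real.exp (-(2 * p 2)) := by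
    rw [hα, ← Real.exp_add, h]; congr 1; simp; ring
  have e1 : Real.exp (2 * φ p 2) * β ^ 2 = Real.exp (2 * p 2) := by
    rw [hβ, ← Real.exp_add, h]; congr 1; simp; ring
  simp
  linear_combination v 0 * w 0 * e0 + v 1 * w 1 * e1

theorem IsSwap.solMetric_fderiv {φ : Sol → Sol} (h : IsSwap φ) (p v w : Sol) :
    solMetric (φ p) (fderiv ℝ φ p v) (fderiv ℝ φ p w) = solMetric p v w := by
  have hd := h.contDiff.differentiable (by simp) p
  obtain ⟨α, β, c, a, b, hα, hβ, h⟩ := h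
  have k := fun i => fderiv_apply_coord hd v i
  have k' := fun i => fderiv_apply_coord hd w i
  have d0 : HasFDerivAt (fun q : Sol => φ q 0) (α • (EuclideanSpace.proj 1 : Sol →L[ℝ] ℝ)) p := by
    simpa [h] using ((hasFDerivAt_coord 1 p).const_mul α).add_const a
  have d1 : HasFDerivAt (fun q : Sol => φ q 1) (β • (EuclideanSpace.proj 0 : Sol →L[ℝ] ℝ)) p := by
    simpa [h] using ((hasFDerivAt_coord 0 p).const_mul β).add_const b
  have d2 : HasFDerivAt (fun q : Sol => φ q 2) (-(EuclideanSpace.proj 2 : Sol →L[ℝ] ℝ)) p := by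
    simpa [h] using (hasFDerivAt_coord 2 p).neg.add_const c
  rw [solMetric_eq, solMetric_eq, k, k, k, k', k', k', d0.fderiv, d1.fderiv, d2.fderiv]
  have e0 : Real.exp (-(2 * φ p 2)) * α ^ 2 = Real.exp (2 * p 2) := by
    rw [hα, ← Real.exp_add, h]; congr 1; simp; ring
  have e1 : Real.exp (2 * φ p 2) * β ^ 2 = Real.exp (-(2 * p 2)) := by
    rw [hβ, ← Real.exp_add, h]; congr 1; simp; ring
  simp
  linear_combination v 1 * w 1 * e0 + v 0 * w 0 * e1

theorem IsStraight.symm {φ : Equiv.Perm Sol} (h : IsStraight φ) : IsStraight φ.symm := by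
  obtain ⟨α, β, c, a, b, hα, hβ, h⟩ := h
  have hα0 : α ≠ 0 := by rintro rfl; exact absurd hα (by simp [(Real.exp_pos _).ne])
  have hβ0 : β ≠ 0 := by rintro rfl; exact absurd hβ (by simp [(Real.exp_pos _).ne])
  refine ⟨α⁻¹, β⁻¹, -c, -(α⁻¹ * a), -(β⁻¹ * b), ?_, ?_, fun p => ?_⟩
  · rw [inv_pow, hα, ← Real.exp_neg, mul_neg]
  · rw [inv_pow, hβ, ← Real.exp_neg, mul_neg]
  · rw [Equiv.symm_apply_eq, h]
    ext i
    fin_cases i <;> simp <;> field_simp <;> ring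

theorem IsSwap.symm {φ : Equiv.Perm Sol} (h : IsSwap φ) : IsSwap φ.symm := by
  obtain ⟨α, β, c, a, b, hα, hβ, h⟩ := h
  have hα0 : α ≠ 0 := by rintro rfl; exact absurd hα (by simp [(Real.exp_pos _).ne])
  have hβ0 : β ≠ 0 := by rintro rfl; exact absurd hβ (by simp [(Real.exp_pos _).ne])
  refine ⟨β⁻¹, α⁻¹, c, -(β⁻¹ * b), -(α⁻¹ * a), ?_, ?_, fun p => ?_⟩
  · rw [inv_pow, hβ, ← Real.exp_neg, neg_neg]
  · rw [inv_pow, hα, ← Real.exp_neg]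
  · rw [Equiv.symm_apply_eq, h]
    ext i
    fin_cases i <;> simp <;> field_simp <;> ring

theorem isSolIsometry_iff {φ : Equiv.Perm Sol} : IsSolIsometry φ ↔ IsStraight φ ∨ IsSwap φ :=
  ⟨fun h => h.isStraight_or_isSwap, fun h => h.elim
    (fun h => ⟨h.contDiff, h.symm.contDiff, h.solMetric_fderiv⟩)
    (fun h => ⟨h.contDiff, h.symm.contDiff, h.solMetric_fderiv⟩)⟩

/-- The automorphism `(x, y, z) ↦ (r x, r y, z)` of Sol. -/
def dilation (r : ℝ) (hr : r ≠ 0) : Equiv.Perm Sol where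
  toFun p := !₂[r * p 0, r * p 1, p 2]
  invFun p := !₂[r⁻¹ * p 0, r⁻¹ * p 1, p 2]
  left_inv p := by ext i; fin_cases i <;> simp [hr]
  right_inv p := by ext i; fin_cases i <;> simp [hr]

theorem dilation_apply (r : ℝ) (hr : r ≠ 0) (p : Sol) :
    dilation r hr p = !₂[r * p 0, r * p 1, p 2] := rfl

theorem dilation_inv_apply (r : ℝ) (hr : r ≠ 0) (p : Sol) :
    (dilation r hr)⁻¹ p = !₂[r⁻¹ * p 0, r⁻¹ * p 1, p 2] := rfl

theorem contDiff_dilation (r : ℝ) (hr : r ≠ 0) : ContDiff ℝ ∞ (dilation r hr) := by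
  refine contDiff_of_coord fun i => ?_
  simp only [dilation_apply]
  fin_cases i <;> simp <;> fun_prop

theorem contDiff_dilation_symm (r : ℝ) (hr : r ≠ 0) : ContDiff ℝ ∞ (dilation r hr).symm := by
  refine contDiff_of_coord fun i => ?_
  change ContDiff ℝ ∞ fun p : Sol => (!₂[r⁻¹ * p 0, r⁻¹ * p 1, p 2] : Sol) i
  fin_cases i <;> simp <;> fun_prop

/-- The linear coefficients and the vertical shift commute with a uniform horizontal scaling; only
the horizontal translation part is multiplied by `r`, so both normal forms are preserved. -/
theorem IsSolIsometry.dilation_conj {φ : Equiv.Perm Sol} (h : IsSolIsometry φ) (r : ℝ)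
    (hr : r ≠ 0) : IsSolIsometry (dilation r hr * φ * (dilation r hr)⁻¹) := by
  rw [isSolIsometry_iff] at h ⊢
  refine h.imp ?_ ?_
  · rintro ⟨α, β, c, a, b, hα, hβ, h⟩
    refine ⟨α, β, c, r * a, r * b, hα, hβ, fun p => ?_⟩
    rw [Equiv.Perm.mul_apply, Equiv.Perm.mul_apply, h, dilation_inv_apply, dilation_apply]
    ext i
    fin_cases i <;> simp <;> field_simp
  · rintro ⟨α, β, c, a, b, hα, hβ, h⟩
    refine ⟨α, β, c, r * a, r * b, hα, hβ, fun p => ?_⟩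
    rw [Equiv.Perm.mul_apply, Equiv.Perm.mul_apply, h, dilation_inv_apply, dilation_apply]
    ext i
    fin_cases i <;> simp <;> field_simp

/-- Reversing `Z` twice restores it. Replacing a closing isometry by its square, and the period by
its double, spares a separate study of closing isometries that reverse `Z`. -/
theorem IsSolIsometry.isStraight_mul_self {φ : Equiv.Perm Sol} (h : IsSolIsometry φ) :
    IsStraight (φ * φ) := by
  rcases h.isStraight_or_isSwap with h | h
  · obtain ⟨α, β, c, a, b, hα, hβ, h⟩ := h
    refine ⟨α * α, β * β, c + c, α * a + a, β * b + b, ?_, ?_, fun p => ?_⟩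
    · rw [mul_pow, hα, ← Real.exp_add]; congr 1; ring
    · rw [mul_pow, hβ, ← Real.exp_add]; congr 1; ring
    · rw [Equiv.Perm.mul_apply, h, h]
      ext i
      fin_cases i <;> simp <;> ring
  · obtain ⟨α, β, c, a, b, hα, hβ, h⟩ := h
    refine ⟨α * β, β * α, 0, α * b + a, β * a + b, ?_, ?_, fun p => ?_⟩
    · rw [mul_pow, hα, hβ, ← Real.exp_add]; simp
    · rw [mul_pow, hα, hβ, ← Real.exp_add]; simp
    · rw [Equiv.Perm.mul_apply, h, h]
      ext i
      fin_cases i <;> simp <;> ring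

/-- `φ` is the horizontal translation by `(a, b, 0)`. -/
def IsHorizontal (φ : Sol → Sol) (a b : ℝ) : Prop :=
  ∀ p, φ p = !₂[p 0 + a, p 1 + b, p 2]

/-- The absolute value of the product of the components of a horizontal translation is invariant
under conjugation by isometries. -/
theorem IsSolIsometry.abs_mul_eq_of_conj {φ τ τ' : Equiv.Perm Sol} (h : IsSolIsometry φ)
    (hτ : φ * τ = τ' * φ) {a b a' b' : ℝ} (hab : IsHorizontal τ a b)
    (hab' : IsHorizontal τ' a' b') : |a * b| = |a' * b'| := by
  have e := congrArg (fun ψ : Equiv.Perm Sol => ψ 0) hτ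
  simp only [Equiv.Perm.mul_apply] at e
  rw [hab' (φ 0), hab 0] at e
  rw [← sq_eq_sq_iff_abs_eq_abs]
  rcases h.isStraight_or_isSwap with ⟨α, β, c, x, y, hα, hβ, h⟩ | ⟨α, β, c, x, y, hα, hβ, h⟩
  -- The horizontal linear part of an isometry has determinant `±1`, so scaling one component is
  -- compensated by scaling the other.
  · have e1 : α ^ 2 * β ^ 2 = 1 := by rw [hα, hβ, ← Real.exp_add]; simp
    rw [h, h] at e
    have h0 := congrArg (fun p : Sol => p 0) e
    have h1 := congrArg (fun p : Sol => p 1) e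
    simp at h0 h1
    rw [show a' = α * a by linarith, show b' = β * b by linarith]
    linear_combination (-(a * b) ^ 2) * e1
  · have e1 : α ^ 2 * β ^ 2 = 1 := by rw [hα, hβ, ← Real.exp_add]; simp
    rw [h, h] at e
    have h0 := congrArg (fun p : Sol => p 0) e
    have h1 := congrArg (fun p : Sol => p 1) e
    simp at h0 h1
    rw [show a' = α * b by linarith, show b' = β * a by linarith]
    linear_combination (-(a * b) ^ 2) * e1

/-! ### Geodesics in coordinates -/

variable {γ : ℝ → Sol}

theorem hasDerivAt_coord {f : ℝ → Sol} {f' : Sol} {t : ℝ} (hf : HasDerivAt f f' t) (i : Fin 3) :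
    HasDerivAt (fun s => f s i) (f' i) t :=
  (hasFDerivAt_coord i _).comp_hasDerivAt t hf

namespace IsUnitGeodesic

theorem hasDerivAt (h : IsUnitGeodesic γ) (t : ℝ) : HasDerivAt γ (deriv γ t) t :=
  (ContinuousLinearMap.fst ℝ Sol Sol).hasFDerivAt.comp_hasDerivAt t (h.1 t)

theorem continuous (h : IsUnitGeodesic γ) : Continuous γ :=
  continuous_iff_continuousAt.2 fun t => (h.hasDerivAt t).continuousAt

theorem hasDerivAt_deriv (h : IsUnitGeodesic γ) (t : ℝ) :
    HasDerivAt (deriv γ) !₂[2 * deriv γ t 2 * deriv γ t 0, -(2 * deriv γ t 2 * deriv γ t 1),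
      Real.exp (2 * γ t 2) * deriv γ t 1 ^ 2 - Real.exp (-(2 * γ t 2)) * deriv γ t 0 ^ 2] t := by
  have := (ContinuousLinearMap.snd ℝ Sol Sol).hasFDerivAt.comp_hasDerivAt t (h.1 t)
  rw [geodesicField_eq] at this
  exact this

theorem unit (h : IsUnitGeodesic γ) (t : ℝ) :
    Real.exp (-(2 * γ t 2)) * deriv γ t 0 ^ 2 + Real.exp (2 * γ t 2) * deriv γ t 1 ^ 2 +
      deriv γ t 2 ^ 2 = 1 := by
  have := h.2 t
  rw [solMetric_eq] at this
  linarith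

/-- Conservation of the momentum conjugate to `x`. -/
theorem exists_momentum_x (h : IsUnitGeodesic γ) :
    ∃ P : ℝ, ∀ t, deriv γ t 0 = P * Real.exp (2 * γ t 2) := by
  have hd : ∀ t, HasDerivAt (fun s => deriv γ s 0 * Real.exp (-(2 * γ s 2))) 0 t := by
    intro t
    have := (hasDerivAt_coord (h.hasDerivAt_deriv t) 0).mul
      (((hasDerivAt_coord (h.hasDerivAt t) 2).const_mul 2).neg.exp)
    refine this.congr_deriv ?_
    simp
    ring
  refine ⟨deriv γ 0 0 * Real.exp (-(2 * γ 0 2)), fun t => ?_⟩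
  have := is_const_of_deriv_eq_zero (fun t => (hd t).differentiableAt) (fun t => (hd t).deriv) t 0
  rw [← this, mul_assoc, ← Real.exp_add]
  simp

/-- Conservation of the momentum conjugate to `y`. -/
theorem exists_momentum_y (h : IsUnitGeodesic γ) :
    ∃ Q : ℝ, ∀ t, deriv γ t 1 = Q * Real.exp (-(2 * γ t 2)) := by
  have hd : ∀ t, HasDerivAt (fun s => deriv γ s 1 * Real.exp (2 * γ s 2)) 0 t := by
    intro t
    have := (hasDerivAt_coord (h.hasDerivAt_deriv t) 1).mul
      (((hasDerivAt_coord (h.hasDerivAt t) 2).const_mul 2).exp)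
    refine this.congr_deriv ?_
    simp
    ring
  refine ⟨deriv γ 0 1 * Real.exp (2 * γ 0 2), fun t => ?_⟩
  have := is_const_of_deriv_eq_zero (fun t => (hd t).differentiableAt) (fun t => (hd t).deriv) t 0
  rw [← this, mul_assoc, ← Real.exp_add]
  simp

/-- An isometry preserving the direction of `Z` which closes up a geodesic with nonzero momenta is a
horizontal translation. -/
theorem exists_isHorizontal (h : IsUnitGeodesic γ) {P Q : ℝ}
    (hP : ∀ t, deriv γ t 0 = P * Real.exp (2 * γ t 2))
    (hQ : ∀ t, deriv γ t 1 = Q * Real.exp (-(2 * γ t 2))) (hP0 : P ≠ 0) (hQ0 : Q ≠ 0)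
    {φ : Sol → Sol} (hφ : IsStraight φ) {T : ℝ} (hT : ∀ t, γ (t + T) = φ (γ t)) :
    ∃ a b, IsHorizontal φ a b := by
  obtain ⟨α, β, c, a, b, hα, hβ, hφ⟩ := hφ
  have e1 : ∀ x : ℝ, Real.exp (-x) * Real.exp x = 1 := fun x => by rw [← Real.exp_add]; simp
  -- Unit speed confines `z` to a bounded interval: `P ≠ 0` bounds it above here, and `Q ≠ 0` bounds
  -- it below in `hb2`.
  have hb1 : ∀ t, Real.exp (2 * γ t 2) * P ^ 2 ≤ 1 := by
    intro t
    have := h.unit t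
    rw [hP] at this
    have k : Real.exp (-(2 * γ t 2)) * (P * Real.exp (2 * γ t 2)) ^ 2 =
        Real.exp (2 * γ t 2) * P ^ 2 := by
      linear_combination P ^ 2 * Real.exp (2 * γ t 2) * e1 (2 * γ t 2)
    rw [k] at this
    have : 0 ≤ Real.exp (2 * γ t 2) * deriv γ t 1 ^ 2 + deriv γ t 2 ^ 2 := by positivity
    linarith
  have hb2 : ∀ t, Real.exp (-(2 * γ t 2)) * Q ^ 2 ≤ 1 := by
    intro t
    have := h.unit t
    rw [hQ] at this
    have k : Real.exp (2 * γ t 2) * (Q * Real.exp (-(2 * γ t 2))) ^ 2 =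
        Real.exp (-(2 * γ t 2)) * Q ^ 2 := by
      linear_combination Q ^ 2 * Real.exp (-(2 * γ t 2)) * e1 (2 * γ t 2)
    rw [k] at this
    have : 0 ≤ Real.exp (-(2 * γ t 2)) * deriv γ t 0 ^ 2 + deriv γ t 2 ^ 2 := by positivity
    linarith
  have hz : ∀ t, γ (t + T) 2 = γ t 2 + c := fun t => by rw [hT, hφ]; rfl
  have hn : ∀ n : ℕ, γ (n * T) 2 = γ 0 2 + n * c := by
    intro n
    induction n with
    | zero => simp
    | succ n ih => rw [show ((n + 1 : ℕ) : ℝ) * T = n * T + T by push_cast; ring, hz, ih]; push_cast; ring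
  -- A nonzero shift of `z` at each period would accumulate and leave the bounded interval.
  have hc : c = 0 := by
    rcases lt_trichotomy c 0 with hc | hc | hc
    · obtain ⟨n, hn'⟩ := exists_nat_gt ((1 / (Real.exp (-(2 * γ 0 2)) * Q ^ 2)) / (-(2 * c)))
      have k := hb2 (n * T)
      rw [hn, show -(2 * (γ 0 2 + n * c)) = -(2 * γ 0 2) + n * (-(2 * c)) by ring,
        Real.exp_add] at k
      rw [div_lt_iff₀ (by linarith), div_lt_iff₀ (by positivity)] at hn'
      have := Real.add_one_le_exp (n * (-(2 * c)))
      have pos : 0 < Real.exp (-(2 * γ 0 2)) * Q ^ 2 := by positivity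
      nlinarith
    · exact hc
    · obtain ⟨n, hn'⟩ := exists_nat_gt ((1 / (Real.exp (2 * γ 0 2) * P ^ 2)) / (2 * c))
      have k := hb1 (n * T)
      rw [hn, show (2 * (γ 0 2 + n * c)) = 2 * γ 0 2 + n * (2 * c) by ring,
        Real.exp_add] at k
      rw [div_lt_iff₀ (by linarith), div_lt_iff₀ (by positivity)] at hn'
      have := Real.add_one_le_exp (n * (2 * c))
      have pos : 0 < Real.exp (2 * γ 0 2) * P ^ 2 := by positivity
      nlinarith
  subst hc
  have z0 : γ T 2 = γ 0 2 := by simpa using hz 0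
  have hγT : ∀ i, HasDerivAt (fun s => γ (s + T) i) (deriv γ T i) 0 := fun i => by
    simpa using (hasDerivAt_coord (h.hasDerivAt (0 + T)) i).comp_add_const (0 : ℝ) T
  have d0 : deriv γ T 0 = α * deriv γ 0 0 := by
    refine (hγT 0).unique ?_
    have : (fun s => γ (s + T) 0) = fun s => α * γ s 0 + a := by ext s; rw [hT, hφ]; rfl
    rw [this]
    exact ((hasDerivAt_coord (h.hasDerivAt 0) 0).const_mul α).add_const a
  have d1 : deriv γ T 1 = β * deriv γ 0 1 := by
    refine (hγT 1).unique ?_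
    have : (fun s => γ (s + T) 1) = fun s => β * γ s 1 + b := by ext s; rw [hT, hφ]; rfl
    rw [this]
    exact ((hasDerivAt_coord (h.hasDerivAt 0) 1).const_mul β).add_const b
  rw [hP, hP, z0] at d0
  rw [hQ, hQ, z0] at d1
  -- As `z` returns to its value, conservation of momentum gives equal nonzero horizontal velocities
  -- at times `0` and `T`, so `α` cannot rescale them; the same holds for `β`.
  have hα1 : α = 1 := by
    have : P * Real.exp (2 * γ 0 2) ≠ 0 := mul_ne_zero hP0 (Real.exp_pos _).ne'
    exact mul_right_cancel₀ this (by linarith)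
  have hβ1 : β = 1 := by
    have : Q * Real.exp (-(2 * γ 0 2)) ≠ 0 := mul_ne_zero hQ0 (Real.exp_pos _).ne'
    exact mul_right_cancel₀ this (by linarith)
  exact ⟨a, b, fun p => by rw [hφ, hα1, hβ1]; simp⟩

end IsUnitGeodesic

/-! ### Closing up geodesics of type C -/

/-- A lower bound for the time taken by a solution of `w'' = - f w`, `0 ≤ f ≤ 2`, to go from a zero
to an extremum of its absolute value. -/
theorem half_le_sq_of_hasDerivAt {w w₁ w₂ : ℝ → ℝ} (hw : ∀ t, HasDerivAt w (w₁ t) t)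
    (hw₁ : ∀ t, HasDerivAt w₁ (w₂ t) t) {t₀ t₁ T : ℝ} (h01 : t₀ ≤ t₁) (h1T : t₁ ≤ t₀ + T)
    (h0 : w t₀ = 0) (h1 : w₁ t₁ = 0) (hpos : w t₁ ≠ 0) (hb : ∀ t, |w₂ t| ≤ 2 * |w t₁|) :
    1 / 2 ≤ T ^ 2 := by
  -- The mean value inequality is used twice: for `w₁` from its zero `t₁`, then for `w` from its
  -- zero `t₀`. The result is `|w t₁| ≤ 2 T² |w t₁|`.
  have b1 : ∀ t, |w₁ t| ≤ 2 * |w t₁| * |t - t₁| := by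
    intro t
    have := convex_univ.norm_image_sub_le_of_norm_hasDerivWithin_le (f := w₁) (f' := w₂)
      (fun x _ => (hw₁ x).hasDerivWithinAt) (fun x _ => hb x) (Set.mem_univ t₁) (Set.mem_univ t)
    simpa [h1] using this
  have b2 := (convex_Icc t₀ t₁).norm_image_sub_le_of_norm_hasDerivWithin_le (f := w) (f' := w₁)
      (C := 2 * |w t₁| * T)
      (fun x _ => (hw x).hasDerivWithinAt) (fun x hx => (b1 x).trans (by
        gcongr
        rw [abs_le]
        constructor <;> linarith [hx.1, hx.2])) (Set.left_mem_Icc.2 h01) (Set.right_mem_Icc.2 h01)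
  rw [h0, sub_zero, Real.norm_eq_abs, Real.norm_eq_abs, abs_of_nonneg (sub_nonneg.2 h01)] at b2
  have hp : 0 < |w t₁| := abs_pos.2 hpos
  have hT : 0 ≤ T := by linarith
  have b3 : |w t₁| * 1 ≤ |w t₁| * (2 * T ^ 2) := by
    calc |w t₁| * 1 ≤ 2 * |w t₁| * T * (t₁ - t₀) := by simpa using b2
      _ ≤ 2 * |w t₁| * T * T := by gcongr; linarith
      _ = _ := by ring
  linarith [le_of_mul_le_mul_left b3 hp]

/-- If a geodesic of type `C` is closed up by a horizontal translation by `(a, b, 0)`, then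
`|a b|` is bounded below. -/
theorem IsTypeC.le_abs_mul (h : IsTypeC γ) {φ : Sol → Sol} (hφ : IsStraight φ) {T : ℝ} (hT0 : 0 < T)
    (hT : ∀ t, γ (t + T) = φ (γ t)) : ∃ a b, IsHorizontal φ a b ∧ 1 / 8 ≤ |a * b| := by
  obtain ⟨h, hA, hB⟩ := h
  obtain ⟨P, hP⟩ := h.exists_momentum_x
  obtain ⟨Q, hQ⟩ := h.exists_momentum_y
  have hx := fun t => hasDerivAt_coord (h.hasDerivAt t) 0
  have hy := fun t => hasDerivAt_coord (h.hasDerivAt t) 1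
  have hz := fun t => hasDerivAt_coord (h.hasDerivAt t) 2
  have hconst : ∀ i, (∀ t, deriv γ t i = 0) → ∀ t, γ t i = γ 0 i := fun i hi t =>
    is_const_of_deriv_eq_zero (fun t => (hasDerivAt_coord (h.hasDerivAt t) i).differentiableAt)
      (fun t => ((hasDerivAt_coord (h.hasDerivAt t) i).deriv).trans (hi t)) t 0
  have hP0 : P ≠ 0 := by
    rintro rfl
    exact hB ⟨h, Or.inr (hconst 0 fun t => by simp [hP])⟩
  have hQ0 : Q ≠ 0 := by
    rintro rfl
    exact hB ⟨h, Or.inl (hconst 1 fun t => by simp [hQ])⟩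
  obtain ⟨a, b, hab⟩ := h.exists_isHorizontal hP hQ hP0 hQ0 hφ hT
  refine ⟨a, b, hab, ?_⟩
  have e1 : ∀ x : ℝ, Real.exp (-x) * Real.exp x = 1 := fun x => by rw [← Real.exp_add]; simp
  -- `A = ⟨γ', X⟩²`, `B = ⟨γ', Y⟩²`, `w = ⟨γ', Z⟩`
  obtain ⟨A, hAd⟩ : ∃ A : ℝ → ℝ, ∀ t, A t = P ^ 2 * Real.exp (2 * γ t 2) := ⟨_, fun _ => rfl⟩
  obtain ⟨B, hBd⟩ : ∃ B : ℝ → ℝ, ∀ t, B t = Q ^ 2 * Real.exp (-(2 * γ t 2)) := ⟨_, fun _ => rfl⟩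
  obtain ⟨w, hwd⟩ : ∃ w : ℝ → ℝ, ∀ t, w t = deriv γ t 2 := ⟨_, fun _ => rfl⟩
  simp only [← hwd] at hz
  have hApos : ∀ t, 0 < A t := fun t => by rw [hAd]; positivity
  have hBpos : ∀ t, 0 < B t := fun t => by rw [hBd]; positivity
  have hxA : ∀ t, HasDerivAt (fun s => P * γ s 0) (A t) t := fun t =>
    ((hx t).const_mul P).congr_deriv (by rw [hP, hAd]; ring)
  have hyB : ∀ t, HasDerivAt (fun s => Q * γ s 1) (B t) t := fun t =>
    ((hy t).const_mul Q).congr_deriv (by rw [hQ, hBd]; ring)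
  have hw' : ∀ t, HasDerivAt w (B t - A t) t := by
    intro t
    have := hasDerivAt_coord (h.hasDerivAt_deriv t) 2
    rw [show (fun s => deriv γ s 2) = w from funext fun s => (hwd s).symm] at this
    refine this.congr_deriv ?_
    simp only [hP, hQ, hAd, hBd]
    simp
    linear_combination (Q ^ 2 * Real.exp (-(2 * γ t 2)) - P ^ 2 * Real.exp (2 * γ t 2)) *
      e1 (2 * γ t 2)
  have hunit : ∀ t, A t + B t + w t ^ 2 = 1 := by
    intro t
    have := h.unit t
    rw [hP, hQ, ← hwd] at this
    rw [hAd, hBd]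
    linear_combination this - (P ^ 2 * Real.exp (2 * γ t 2) + Q ^ 2 * Real.exp (-(2 * γ t 2))) *
      e1 (2 * γ t 2)
  have hA' : ∀ t, HasDerivAt A (2 * w t * A t) t := by
    intro t
    have := (((hz t).const_mul 2).exp).const_mul (P ^ 2)
    rw [show A = fun s => P ^ 2 * Real.exp (2 * γ s 2) from funext hAd]
    exact this.congr_deriv (by ring)
  have hB' : ∀ t, HasDerivAt B (-(2 * w t * B t)) t := by
    intro t
    have := (((hz t).const_mul 2).neg.exp).const_mul (Q ^ 2)
    rw [show B = fun s => Q ^ 2 * Real.exp (-(2 * γ s 2)) from funext hBd]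
    exact this.congr_deriv (by simp only [Pi.neg_apply]; ring)
  have hw'' : ∀ t, HasDerivAt (fun s => B s - A s) (-(2 * w t * (A t + B t))) t := fun t =>
    ((hB' t).sub (hA' t)).congr_deriv (by ring)
  obtain ⟨k, hk⟩ : ∃ k, k = |P * Q| := ⟨_, rfl⟩
  have hkpos : 0 < k := hk ▸ abs_pos.2 (mul_ne_zero hP0 hQ0)
  have hAB : ∀ t, A t * B t = k ^ 2 := fun t => by
    rw [hk, sq_abs, hAd, hBd]; linear_combination P ^ 2 * Q ^ 2 * e1 (2 * γ t 2)
  -- periodicity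
  have zper : ∀ t, γ (t + T) 2 = γ t 2 := fun t => by rw [hT, hab]; rfl
  have xper : ∀ t, γ (t + T) 0 = γ t 0 + a := fun t => by rw [hT, hab]; rfl
  have yper : ∀ t, γ (t + T) 1 = γ t 1 + b := fun t => by rw [hT, hab]; rfl
  have wper : Function.Periodic w T := by
    intro t
    have := (hz (t + T)).comp_add_const t T
    rw [show (fun s => γ (s + T) 2) = fun s => γ s 2 from funext zper] at this
    exact this.unique (hz t)
  have wcont : Continuous w := continuous_iff_continuousAt.2 fun t => (hw' t).continuousAt
  -- `w` does not vanish identically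
  have hwne : ∃ t, w t ≠ 0 := by
    by_contra! hw0
    have hBA : ∀ t, A t = B t := by
      intro t
      have := (hw' t).unique ((hasDerivAt_const t (0 : ℝ)).congr_of_eventuallyEq
        (Filter.Eventually.of_forall hw0))
      linarith
    have hA2 : ∀ t, A t = 1 / 2 := fun t => by
      have := hunit t
      rw [hw0, ← hBA] at this
      linarith
    have key : ∀ R u : ℝ, (R * Real.exp u) ^ 2 = 1 / 2 →
        ∀ s, R = s * |R| → R * Real.exp u = (Real.sqrt 2)⁻¹ * s := by
      intro R u hR s hs
      have : |R| * Real.exp u = (Real.sqrt 2)⁻¹ := by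
        rw [← Real.sqrt_inv, eq_comm, Real.sqrt_eq_iff_mul_self_eq_of_pos]
        · rw [← sq, mul_pow, sq_abs, ← mul_pow, hR]; norm_num
        · have : R ≠ 0 := by rintro rfl; norm_num at hR
          positivity
      rw [hs, mul_assoc, this, mul_comm]
    have hsgn : ∀ R : ℝ, R ≠ 0 → ∃ s : ℝ, (s = 1 ∨ s = -1) ∧ R = s * |R| := by
      intro R hR
      rcases lt_or_gt_of_ne hR with hR | hR
      · exact ⟨-1, Or.inr rfl, by rw [abs_of_neg hR]; ring⟩
      · exact ⟨1, Or.inl rfl, by rw [abs_of_pos hR]; ring⟩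
    obtain ⟨s, hs, hs'⟩ := hsgn P hP0
    obtain ⟨r, hr, hr'⟩ := hsgn Q hQ0
    have e2 : ∀ x : ℝ, Real.exp (2 * x) = Real.exp x ^ 2 := fun x => by
      rw [← Real.exp_nat_mul]; norm_num
    refine hA ⟨h, s, r, hs, hr, fun t => ?_⟩
    have a1 := key P (γ t 2) (by rw [mul_pow, ← e2, ← hAd, hA2]) s hs'
    have a2 := key Q (-γ t 2) (by rw [mul_pow, ← e2, mul_neg, ← hBd, ← hBA, hA2]) r hr'
    ext i
    fin_cases i
    · simp [fieldX, fieldY, hP, e2]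
      linear_combination Real.exp (γ t 2) * a1
    · simp [fieldX, fieldY, hQ]
      rw [← mul_neg, e2]
      linear_combination Real.exp (-γ t 2) * a2
    · simp [fieldX, fieldY, ← hwd, hw0]
  -- a zero `t₀` and a maximum `t₁` of `|w|`
  obtain ⟨t₀, -, ht₀⟩ : ∃ t ∈ Set.Ioo 0 T, w t = 0 :=
    exists_hasDerivAt_eq_zero hT0 (fun t _ => (hz t).continuousAt.continuousWithinAt)
      (by simpa using (zper 0).symm) (fun t _ => hz t)
  obtain ⟨t₁, ht₁, hmax⟩ := isCompact_Icc.exists_isMaxOn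
    (Set.nonempty_Icc.2 (by linarith : t₀ ≤ t₀ + T)) (wcont.pow 2).continuousOn
  have hmax' : ∀ t, w t ^ 2 ≤ w t₁ ^ 2 := by
    intro t
    obtain ⟨s, hs, hs'⟩ := wper.exists_mem_Ico hT0 t t₀
    rw [hs']
    exact hmax ⟨hs.1, hs.2.le⟩
  have hw1 : w t₁ ≠ 0 := by
    intro h0
    obtain ⟨t, ht⟩ := hwne
    have := hmax' t
    rw [h0] at this
    have : 0 < w t ^ 2 := by positivity
    linarith
  -- At the maximum of `w²` the derivative `w' = B - A` vanishes; since `A B = k²`, both equal `k`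
  -- there and unit speed gives `w² = 1 - 2k`.
  have hBA1 : B t₁ - A t₁ = 0 := by
    have hloc : IsLocalMax (fun t => w t ^ 2) t₁ := Filter.Eventually.of_forall hmax'
    have := hloc.hasDerivAt_eq_zero ((hw' t₁).pow 2)
    simpa [hw1] using this
  have hAk : A t₁ = k := by
    have := hAB t₁
    rw [show B t₁ = A t₁ by linarith, ← sq] at this
    exact (sq_eq_sq₀ (hApos _).le hkpos.le).1 this
  have hW : w t₁ ^ 2 = 1 - 2 * k := by linarith [hunit t₁]
  -- the increment `m` of `P x` and of `Q y` over a period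
  have hm : P * a = Q * b := by
    have hc : ∀ t, HasDerivAt (fun s => w s + P * γ s 0 - Q * γ s 1) 0 t := fun t =>
      (((hw' t).add (hxA t)).sub (hyB t)).congr_deriv (by ring)
    have := is_const_of_deriv_eq_zero (fun t => (hc t).differentiableAt) (fun t => (hc t).deriv)
      (0 + T) 0
    rw [wper, xper, yper] at this
    linarith
  have mono : ∀ (f f' : ℝ → ℝ), (∀ t, HasDerivAt f (f' t) t) → (∀ t, 0 ≤ f' t) → Monotone f :=
    fun f f' hf hf' => monotone_of_hasDerivAt_nonneg hf hf'
  -- `A + B` dominates `|w'|`, so its integral over a period, which is `2 P a`, bounds the variation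
  -- of `w` from `t₀` to `t₁`. In `m4` the inequality `A + B ≥ 2k` bounds the same integral below by
  -- `2 k T`.
  have m1 := mono _ _ (fun t => ((hxA t).add (hyB t)).add (hw' t)) (fun t => by linarith [hBpos t])
  have m2 := mono _ _ (fun t => ((hxA t).add (hyB t)).sub (hw' t)) (fun t => by linarith [hApos t])
  have m3 := mono _ _ (fun t => (hxA t).add (hyB t))
    (fun t => by linarith [hApos t, hBpos t])
  have m4 := mono _ _ (fun t => ((hxA t).add (hyB t)).sub ((hasDerivAt_id t).const_mul (2 * k)))
    (fun t => by nlinarith [sq_nonneg (A t - B t), hAB t, hApos t, hBpos t])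
  have i1 := m1 ht₁.1
  have i2 := m2 ht₁.1
  have i3 := m3 ht₁.2
  have i4 := m4 (show (0 : ℝ) ≤ 0 + T by linarith)
  simp only [Pi.add_apply, Pi.sub_apply, id, xper, yper] at i1 i2 i3 i4
  have hmW : |w t₁| ≤ 2 * (P * a) := abs_le.2 ⟨by linarith, by linarith⟩
  have hmk : k * T ≤ P * a := by linarith
  have hTsq : 1 / 2 ≤ T ^ 2 := by
    refine half_le_sq_of_hasDerivAt hw' hw'' ht₁.1 ht₁.2 ht₀ hBA1 hw1 fun t => ?_
    rw [abs_neg, abs_mul, abs_mul, abs_of_pos (add_pos (hApos t) (hBpos t))]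
    have : A t + B t ≤ 1 := by nlinarith [hunit t]
    have h1 := sq_le_sq.1 (hmax' t)
    simp only [Nat.abs_ofNat]
    nlinarith [abs_nonneg (w t), hApos t, hBpos t]
  have habs : k * |a * b| = (P * a) ^ 2 := by
    rw [hk, ← abs_mul, show P * Q * (a * b) = (P * a) * (Q * b) by ring, ← hm, ← sq, abs_sq]
  have hsqW : 1 - 2 * k ≤ 4 * (P * a) ^ 2 := by
    rw [← hW, ← sq_abs]
    nlinarith [abs_nonneg (w t₁)]
  have hsqk : k ^ 2 * (1 / 2) ≤ (P * a) ^ 2 := by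
    calc k ^ 2 * (1 / 2) ≤ k ^ 2 * T ^ 2 := by gcongr
      _ = (k * T) ^ 2 := by ring
      _ ≤ _ := by gcongr
  refine le_of_mul_le_mul_left (a := k) ?_ hkpos
  rw [habs]
  -- With `m = P a`, the invariant is `m² / k`. The variation of `w` gives `m² ≥ (1 - 2k) / 4`,
  -- useful for small `k`; the bound `T² ≥ 1/2` gives `m² ≥ k² / 2`, useful for large `k`. Cutting
  -- at `1/4` makes the second equal `k / 8` at the threshold.
  rcases le_total k (1 / 4) with hk4 | hk4
  · linarith
  · nlinarith

/-- If a geodesic of type `A` is closed up after time `T` by a horizontal translation by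
`(a, b, 0)`, then `|a b| = T² / 2`. -/
theorem IsTypeA.abs_mul_eq (h : IsTypeA γ) {φ : Sol → Sol} (hφ : IsStraight φ) {T : ℝ}
    (hT : ∀ t, γ (t + T) = φ (γ t)) : ∃ a b, IsHorizontal φ a b ∧ |a * b| = T ^ 2 / 2 := by
  obtain ⟨h, s, r, hs, hr, hv⟩ := h
  obtain ⟨P, hP⟩ := h.exists_momentum_x
  obtain ⟨Q, hQ⟩ := h.exists_momentum_y
  have h0 : ∀ t, deriv γ t 0 = (Real.sqrt 2)⁻¹ * (s * Real.exp (γ t 2)) := fun t => by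
    rw [hv]; simp [fieldX, fieldY]
  have h1 : ∀ t, deriv γ t 1 = (Real.sqrt 2)⁻¹ * (r * Real.exp (-γ t 2)) := fun t => by
    rw [hv]; simp [fieldX, fieldY]
  have h2 : ∀ t, deriv γ t 2 = 0 := fun t => by
    rw [hv]; simp [fieldX, fieldY]
  have hs2 : s ^ 2 = 1 := by rcases hs with rfl | rfl <;> norm_num
  have hr2 : r ^ 2 = 1 := by rcases hr with rfl | rfl <;> norm_num
  have hs0 : s ≠ 0 := by rintro rfl; norm_num at hs2
  have hr0 : r ≠ 0 := by rintro rfl; norm_num at hr2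
  have h2' : (Real.sqrt 2)⁻¹ ^ 2 = 1 / 2 := by rw [inv_pow, Real.sq_sqrt (by norm_num)]; norm_num
  have hP0 : P ≠ 0 := by
    rintro rfl
    have := hP 0
    rw [h0] at this
    simp [hs0] at this
  have hQ0 : Q ≠ 0 := by
    rintro rfl
    have := hQ 0
    rw [h1] at this
    simp [hr0] at this
  obtain ⟨a, b, hab⟩ := h.exists_isHorizontal hP hQ hP0 hQ0 hφ hT
  refine ⟨a, b, hab, ?_⟩
  have hz : ∀ t, γ t 2 = γ 0 2 := fun t =>
    is_const_of_deriv_eq_zero (fun t => (hasDerivAt_coord (h.hasDerivAt t) 2).differentiableAt)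
      (fun t => ((hasDerivAt_coord (h.hasDerivAt t) 2).deriv).trans (h2 t)) t 0
  have hlin : ∀ (i : Fin 3) (c : ℝ), (∀ t, deriv γ t i = c) → γ T i = γ 0 i + T * c := by
    intro i c hc
    have hd : ∀ t, HasDerivAt (fun s => γ s i - s * c) 0 t := fun t =>
      ((hasDerivAt_coord (h.hasDerivAt t) i).sub ((hasDerivAt_id t).mul_const c)).congr_deriv
        (by rw [hc]; ring)
    have := is_const_of_deriv_eq_zero (fun t => (hd t).differentiableAt) (fun t => (hd t).deriv) T 0
    simp at this
    linarith
  have l0 := hlin 0 _ (fun t => by rw [h0, hz])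
  have l1 := hlin 1 _ (fun t => by rw [h1, hz])
  have hT' := hT 0
  rw [zero_add] at hT'
  rw [hT', hab] at l0 l1
  simp at l0 l1
  rw [l0, l1, ← abs_of_nonneg (by positivity : 0 ≤ T ^ 2 / 2), ← sq_eq_sq_iff_abs_eq_abs]
  have e1 : Real.exp (-γ 0 2) * Real.exp (γ 0 2) = 1 := by rw [← Real.exp_add]; simp
  calc _ = T ^ 4 * ((Real.sqrt 2)⁻¹ ^ 2) ^ 2 * s ^ 2 * r ^ 2 *
        (Real.exp (-γ 0 2) * Real.exp (γ 0 2)) ^ 2 := by ring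
    _ = _ := by rw [h2', hs2, hr2, e1]; ring

/-! ### Symplectic paths which are products of planar ones -/

/-- The infinitesimal symplectic matrix `p_i' = α_i q_i`, `q_i' = β_i p_i`. -/
def blockGenerator (α β : Fin 2 → ℝ) : Matrix (Fin 2 ⊕ Fin 2) (Fin 2 ⊕ Fin 2) ℝ :=
  Matrix.fromBlocks 0 (Matrix.diagonal α) (Matrix.diagonal β) 0

/-- The matrix which is the sum of `p_i • 1` and `s_i` times `blockGenerator α β`. -/
def blockMatrix (α β p s : Fin 2 → ℝ) : Matrix (Fin 2 ⊕ Fin 2) (Fin 2 ⊕ Fin 2) ℝ :=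
  Matrix.fromBlocks (Matrix.diagonal p) (Matrix.diagonal (α * s)) (Matrix.diagonal (β * s))
    (Matrix.diagonal p)

theorem blockMatrix_mem_symplecticGroup {α β p s : Fin 2 → ℝ}
    (h : ∀ i, p i ^ 2 - α i * β i * s i ^ 2 = 1) :
    blockMatrix α β p s ∈ Matrix.symplecticGroup (Fin 2) ℝ := by
  rw [SymplecticGroup.mem_iff, blockMatrix, Matrix.J, Matrix.fromBlocks_transpose,
    Matrix.fromBlocks_multiply, Matrix.fromBlocks_multiply]
  simp only [Matrix.diagonal_transpose, Matrix.diagonal_mul_diagonal, Matrix.diagonal_neg,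
    Matrix.diagonal_add, ← Matrix.diagonal_one, ← Matrix.diagonal_zero]
  congr 2 <;> ext i <;> simp <;> linarith [h i]

/-- The functions `p, s` solve `p' = α β s`, `s' = p`, `p(0) = 1`, `s(0) = 0`. -/
structure IsBlockSolution (α β : Fin 2 → ℝ) (p s : ℝ → Fin 2 → ℝ) : Prop where
  deriv_p : ∀ t i, HasDerivAt (fun t => p t i) (α i * β i * s t i) t
  deriv_s : ∀ t i, HasDerivAt (fun t => s t i) (p t i) t
  p_zero : p 0 = 1
  s_zero : s 0 = 0

namespace IsBlockSolution

variable {α β : Fin 2 → ℝ} {p s : ℝ → Fin 2 → ℝ} (h : IsBlockSolution α β p s)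
include h

theorem sq_sub (t : ℝ) (i : Fin 2) : p t i ^ 2 - α i * β i * s t i ^ 2 = 1 := by
  have hd : ∀ t, HasDerivAt (fun t => p t i ^ 2 - α i * β i * s t i ^ 2) 0 t := fun t =>
    (((h.deriv_p t i).pow 2).sub (((h.deriv_s t i).pow 2).const_mul (α i * β i))).congr_deriv
      (by simp; ring)
  have := is_const_of_deriv_eq_zero (fun t => (hd t).differentiableAt) (fun t => (hd t).deriv) t 0
  simpa [h.p_zero, h.s_zero] using this

theorem contDiff_p (i : Fin 2) : ContDiff ℝ 1 fun t => p t i := by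
  rw [contDiff_one_iff_deriv]
  refine ⟨fun t => (h.deriv_p t i).differentiableAt, ?_⟩
  rw [show deriv (fun t => p t i) = fun t => α i * β i * s t i from
    funext fun t => (h.deriv_p t i).deriv]
  exact continuous_const.mul
    (continuous_iff_continuousAt.2 fun t => (h.deriv_s t i).continuousAt)

theorem contDiff_s (i : Fin 2) : ContDiff ℝ 1 fun t => s t i := by
  rw [contDiff_one_iff_deriv]
  refine ⟨fun t => (h.deriv_s t i).differentiableAt, ?_⟩
  rw [show deriv (fun t => s t i) = fun t => p t i from funext fun t => (h.deriv_s t i).deriv]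
  exact (h.contDiff_p i).continuous

theorem path_zero : blockMatrix α β (p 0) (s 0) = 1 := by
  simp [blockMatrix, h.p_zero, h.s_zero]

theorem isSymplecticPath : IsSymplecticPath fun t => blockMatrix α β (p t) (s t) := by
  refine ⟨fun i j => ?_, fun t => blockMatrix_mem_symplecticGroup (h.sq_sub t), h.path_zero⟩
  have hp := h.contDiff_p
  have hs := h.contDiff_s
  have hd : ∀ (f : ℝ → Fin 2 → ℝ), (∀ i, ContDiff ℝ 1 fun t => f t i) → ∀ i j,
      ContDiff ℝ 1 fun t => Matrix.diagonal (f t) i j := by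
    intro f hf i j
    simp only [Matrix.diagonal_apply]
    split_ifs
    · exact hf i
    · exact contDiff_const
  rcases i with i | i <;> rcases j with j | j
  · exact hd _ hp i j
  · exact hd _ (fun i => contDiff_const.mul (hs i)) i j
  · exact hd _ (fun i => contDiff_const.mul (hs i)) i j
  · exact hd _ hp i j

theorem hasDerivAt_entry (t : ℝ) (i j : Fin 2 ⊕ Fin 2) :
    HasDerivAt (fun t => blockMatrix α β (p t) (s t) i j)
      ((blockGenerator α β * blockMatrix α β (p t) (s t)) i j) t := by
  have hd : ∀ (f : ℝ → Fin 2 → ℝ) (f' : Fin 2 → ℝ), (∀ i, HasDerivAt (fun t => f t i) (f' i) t) →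
      ∀ i j, HasDerivAt (fun t => Matrix.diagonal (f t) i j) (Matrix.diagonal f' i j) t := by
    intro f f' hf i j
    simp only [Matrix.diagonal_apply]
    split_ifs
    · exact hf i
    · exact hasDerivAt_const _ _
  have e : blockGenerator α β * blockMatrix α β (p t) (s t) =
      Matrix.fromBlocks (Matrix.diagonal (α * (β * s t))) (Matrix.diagonal (α * p t))
        (Matrix.diagonal (β * p t)) (Matrix.diagonal (β * (α * s t))) := by
    rw [blockGenerator, blockMatrix, Matrix.fromBlocks_multiply]
    simp [Matrix.diagonal_mul_diagonal]
  rw [e]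
  rcases i with i | i <;> rcases j with j | j
  · exact hd _ _ (fun i => (h.deriv_p t i).congr_deriv (by simp; ring)) i j
  · exact hd _ _ (fun i => (h.deriv_s t i).const_mul (α i)) i j
  · exact hd _ _ (fun i => (h.deriv_s t i).const_mul (β i)) i j
  · exact hd _ _ (fun i => (h.deriv_p t i).congr_deriv (by simp; ring)) i j

theorem matDeriv_eq (t : ℝ) : matDeriv (fun t => blockMatrix α β (p t) (s t)) t =
    blockGenerator α β * blockMatrix α β (p t) (s t) := by
  ext i j
  exact (h.hasDerivAt_entry t i j).deriv

/-- Each planar block has determinant `1` and trace `2 p`, so subtracting the identity leaves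
determinant `2 - 2 p`: the eigenvalue `1` occurs only when `p = 1`. -/
theorem crossingSpace_eq_bot {t : ℝ} (ht : ∀ i, p t i ≠ 1) :
    crossingSpace (fun t => blockMatrix α β (p t) (s t)) t = ⊥ := by
  rw [crossingSpace, LinearMap.ker_eq_bot']
  intro v hv
  have e : ∀ i, (Matrix.toLin' (blockMatrix α β (p t) (s t) - 1) v) i = 0 := fun i => by rw [hv]; rfl
  have e0 : ∀ i, (p t i - 1) * v (.inl i) + α i * s t i * v (.inr i) = 0 := by
    intro i
    have := e (.inl i)
    rw [Matrix.toLin'_apply, Matrix.sub_mulVec, Matrix.one_mulVec, blockMatrix,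
      Matrix.fromBlocks_mulVec] at this
    fin_cases i <;> simp at this ⊢ <;> linarith
  have e1 : ∀ i, β i * s t i * v (.inl i) + (p t i - 1) * v (.inr i) = 0 := by
    intro i
    have := e (.inr i)
    rw [Matrix.toLin'_apply, Matrix.sub_mulVec, Matrix.one_mulVec, blockMatrix,
      Matrix.fromBlocks_mulVec] at this
    fin_cases i <;> simp at this ⊢ <;> linarith
  have hp : ∀ i, 2 - 2 * p t i ≠ 0 := fun i hi => ht i (by linarith)
  ext (i | i)
  · have : (2 - 2 * p t i) * v (.inl i) = 0 := by
      linear_combination (p t i - 1) * e0 i - α i * s t i * e1 i - v (.inl i) * h.sq_sub t i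
    exact (mul_eq_zero.1 this).resolve_left (hp i)
  · have : (2 - 2 * p t i) * v (.inr i) = 0 := by
      linear_combination (p t i - 1) * e1 i - β i * s t i * e0 i - v (.inr i) * h.sq_sub t i
    exact (mul_eq_zero.1 this).resolve_left (hp i)

theorem crossingSpace_zero : crossingSpace (fun t => blockMatrix α β (p t) (s t)) 0 = ⊤ := by
  rw [crossingSpace, h.path_zero]
  simp

/-- At time `0` the derivative of the path is the generator, and multiplying it by the transpose of
`J` makes it diagonal, so the signature is read off the signs of `β` and `-α`. -/
theorem crossingForm_zero (v : crossingSpace (fun t => blockMatrix α β (p t) (s t)) 0) :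
    crossingForm (fun t => blockMatrix α β (p t) (s t)) 0 v =
      QuadraticMap.weightedSumSquares ℝ (Sum.elim β (-α)) (v : Fin 2 ⊕ Fin 2 → ℝ) := by
  have e : (Matrix.J (Fin 2) ℝ).transpose * matDeriv (fun t => blockMatrix α β (p t) (s t)) 0 =
      Matrix.diagonal (Sum.elim β (-α)) := by
    rw [h.matDeriv_eq, h.path_zero, Matrix.mul_one, blockGenerator, Matrix.J,
      Matrix.fromBlocks_transpose, Matrix.fromBlocks_multiply]
    simp [← Matrix.fromBlocks_diagonal]
  rw [crossingForm, e, QuadraticMap.restrict_apply, QuadraticMap.weightedSumSquares_apply]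
  change Matrix.toLinearMap₂' ℝ (Matrix.diagonal (Sum.elim β (-α))) _ _ = _
  simp only [Matrix.toLinearMap₂'_apply, Matrix.diagonal_apply]
  simp
  ring

theorem crossingForm_equivalent : (crossingForm (fun t => blockMatrix α β (p t) (s t)) 0).Equivalent
    (QuadraticMap.weightedSumSquares ℝ (Sum.elim β (-α))) :=
  ⟨{ LinearEquiv.ofTop _ h.crossingSpace_zero with map_app' := fun v => (h.crossingForm_zero v).symm }⟩

theorem isRegularCrossing_zero (h0 : ∀ i, Sum.elim β (-α) i ≠ 0) :
    IsRegularCrossing (fun t => blockMatrix α β (p t) (s t)) 0 := by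
  intro v hv
  ext i
  have := hv ⟨Pi.single i 1, by rw [h.crossingSpace_zero]; trivial⟩
  simp only [QuadraticMap.polar, h.crossingForm_zero, QuadraticMap.weightedSumSquares_apply,
    Submodule.coe_add, Pi.add_apply, ← Finset.sum_sub_distrib] at this
  rw [Finset.sum_eq_single i] at this
  · simp at this
    have h2 : Sum.elim β (-α) i * (2 * (v : Fin 2 ⊕ Fin 2 → ℝ) i) = 0 := by linarith
    simpa [h0 i] using h2
  · intro j _ hj
    simp [hj]
  · simp

/-- The index of a path whose planar components have no crossing in `(0, T]`. -/
theorem hasRegularIndex {T : ℝ} (hT : 0 < T) (h0 : ∀ i, Sum.elim β (-α) i ≠ 0)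
    (hp : ∀ t ∈ Set.Ioc 0 T, ∀ i, p t i ≠ 1) {k : ℤ}
    (hk : 2 * k = ({i | 0 < Sum.elim β (-α) i}.ncard : ℤ) - {i | Sum.elim β (-α) i < 0}.ncard) :
    HasRegularIndex (fun t => blockMatrix α β (p t) (s t)) T k := by
  refine ⟨h.isSymplecticPath, h.crossingSpace_eq_bot (hp T ⟨hT, le_rfl⟩), fun t ht => ?_, ∅,
    fun t => ?_, ?_⟩
  · rcases ht.1.eq_or_lt with rfl | h0t
    · exact h.isRegularCrossing_zero h0
    · intro v _
      exact Subtype.ext ((Submodule.eq_bot_iff _).1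
        (h.crossingSpace_eq_bot (hp t ⟨h0t, ht.2⟩)) v v.2)
  · simp only [Finset.notMem_empty, false_iff, not_and, not_not]
    exact fun ht => h.crossingSpace_eq_bot (hp t ⟨ht.1, ht.2.le⟩)
  · rw [hk, crossingSignature, QuadraticForm.sigPos_of_equiv_weightedSumSquares h.crossingForm_equivalent,
      QuadraticForm.sigNeg_of_equiv_weightedSumSquares h.crossingForm_equivalent]
    simp

/-- The path itself is regular, so the constant homotopy suffices. -/
theorem hasConleyZehnderIndex {T : ℝ} (hT : 0 < T) (h0 : ∀ i, Sum.elim β (-α) i ≠ 0)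
    (hp : ∀ t ∈ Set.Ioc 0 T, ∀ i, p t i ≠ 1) {k : ℤ}
    (hk : 2 * k = ({i | 0 < Sum.elim β (-α) i}.ncard : ℤ) - {i | Sum.elim β (-α) i < 0}.ncard) :
    HasConleyZehnderIndex (fun t => blockMatrix α β (p t) (s t)) T k := by
  have hs := h.isSymplecticPath
  refine ⟨hs, fun _ t => blockMatrix α β (p t) (s t), ?_, fun _ _ t _ => hs.2.1 t,
    fun _ _ => ⟨hs.2.2, h.crossingSpace_eq_bot (hp T ⟨hT, le_rfl⟩)⟩, fun _ _ => rfl,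
    h.hasRegularIndex hT h0 hp hk⟩
  refine Continuous.continuousOn (continuous_matrix fun i j => ?_)
  exact (hs.1 i j).continuous.comp continuous_snd

end IsBlockSolution

/-! ### The index of geodesics of type A -/

/-- The solution `p`, in an unstable and in a stable direction. -/
def waveP (μ ν t : ℝ) : Fin 2 → ℝ := ![Real.cosh (μ * t), Real.cos (ν * t)]

/-- The solution `s`, in an unstable and in a stable direction. -/
def waveS (μ ν t : ℝ) : Fin 2 → ℝ := ![Real.sinh (μ * t) / μ, Real.sin (ν * t) / ν]

theorem isBlockSolution_wave {α β : Fin 2 → ℝ} {μ ν : ℝ} (hμ : μ ≠ 0) (hν : ν ≠ 0)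
    (h0 : α 0 * β 0 = μ ^ 2) (h1 : α 1 * β 1 = -ν ^ 2) :
    IsBlockSolution α β (waveP μ ν) (waveS μ ν) := by
  have l : ∀ c t : ℝ, HasDerivAt (fun t => c * t) c t := fun c t => by
    simpa using (hasDerivAt_id t).const_mul c
  refine ⟨fun t i => ?_, fun t i => ?_, ?_, ?_⟩
  · fin_cases i
    · refine ((l μ t).cosh).congr_deriv ?_
      simp [h0, waveS]
      field_simp
    · refine ((l ν t).cos).congr_deriv ?_
      simp [h1, waveS]
      field_simp
  · fin_cases i
    · refine ((l μ t).sinh.div_const μ).congr_deriv ?_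
      simp [waveP]
      field_simp
    · refine ((l ν t).sin.div_const ν).congr_deriv ?_
      simp [waveP]
      field_simp
  · ext i; fin_cases i <;> simp [waveP]
  · ext i; fin_cases i <;> simp [waveS]

/-- The solution of the unperturbed equation along a geodesic of type `A`. -/
theorem isBlockSolution_typeA : IsBlockSolution ![1, -1] ![0, 2]
    (fun t => ![1, Real.cos (Real.sqrt 2 * t)])
    (fun t => ![t, Real.sin (Real.sqrt 2 * t) / Real.sqrt 2]) := by
  have l : ∀ c t : ℝ, HasDerivAt (fun t => c * t) c t := fun c t => by
    simpa using (hasDerivAt_id t).const_mul c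
  have h2 : Real.sqrt 2 ≠ 0 := by positivity
  have hs : Real.sqrt 2 ^ 2 = 2 := Real.sq_sqrt (by norm_num)
  refine ⟨fun t i => ?_, fun t i => ?_, ?_, ?_⟩
  · fin_cases i
    · refine (hasDerivAt_const t (1 : ℝ)).congr_deriv ?_
      simp
    · refine ((l (Real.sqrt 2) t).cos).congr_deriv ?_
      simp
      field_simp
      rw [hs]
      ring
  · fin_cases i
    · exact hasDerivAt_id t
    · refine ((l (Real.sqrt 2) t).sin.div_const _).congr_deriv ?_
      simp
  · ext i; fin_cases i <;> simp
  · ext i; fin_cases i <;> simp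

/-- The matrix of the linearized geodesic flow along a geodesic of type `A`. -/
def typeAFlow (t : ℝ) : Matrix (Fin 2 ⊕ Fin 2) (Fin 2 ⊕ Fin 2) ℝ :=
  blockMatrix ![1, -1] ![0, 2] ![1, Real.cos (Real.sqrt 2 * t)]
    ![t, Real.sin (Real.sqrt 2 * t) / Real.sqrt 2]

/-- Adding `δJ` changes `α` to `(1 - δ, -(1 + δ))` and `β` to `(δ, 2 + δ)`. The products `α β` are
then positive in the first plane, which becomes hyperbolic and has no later crossing, and negative
in the second, which rotates too slowly to complete a turn before `T`. -/
theorem hasBottIndex_typeAFlow {T : ℝ} (hT : 0 < T) (hT1 : T ≤ 1) :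
    HasBottIndex typeAFlow T 1 := by
  -- For `δ < 1/2` one has `δ (1 - δ) > 0` and `(1 + δ)(2 + δ) < 15/4 < 4`, so the frequency is
  -- below `2` and the angle at times `t ≤ 1` is below `2π`.
  refine ⟨isBlockSolution_typeA.isSymplecticPath, 1 / 2, by norm_num, fun δ ⟨hδ, hδ2⟩ => ?_⟩
  have hμp : 0 < δ * (1 - δ) := by apply mul_pos <;> linarith
  have hνp : 0 < (1 + δ) * (2 + δ) := by positivity
  have hμ : 0 < Real.sqrt (δ * (1 - δ)) := Real.sqrt_pos.2 hμp
  have hν : 0 < Real.sqrt ((1 + δ) * (2 + δ)) := Real.sqrt_pos.2 hνp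
  have hν2 : Real.sqrt ((1 + δ) * (2 + δ)) < 2 := by
    rw [Real.sqrt_lt' (by norm_num)]
    nlinarith
  have h := isBlockSolution_wave (α := ![1 - δ, -(1 + δ)]) (β := ![δ, 2 + δ]) hμ.ne' hν.ne'
    (by rw [Real.sq_sqrt hμp.le]; simp; ring) (by rw [Real.sq_sqrt hνp.le]; simp; ring)
  refine ⟨_, h.path_zero, fun t => ?_, h.hasConleyZehnderIndex hT ?_ ?_ ?_⟩
  · rw [h.matDeriv_eq]
    congr 1
    have hdet : IsUnit (typeAFlow t).det := SymplecticGroup.symplectic_det (isBlockSolution_typeA.isSymplecticPath.2.1 t)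
    have e : matDeriv typeAFlow t = blockGenerator ![1, -1] ![0, 2] * typeAFlow t :=
      isBlockSolution_typeA.matDeriv_eq t
    rw [e, Matrix.mul_nonsing_inv_cancel_right _ _ hdet, Matrix.J, blockGenerator, blockGenerator,
      Matrix.fromBlocks_smul, Matrix.fromBlocks_add]
    congr 1
    · simp
    · ext i j; fin_cases i <;> fin_cases j <;> simp <;> ring
    · ext i j; fin_cases i <;> fin_cases j <;> simp
    · simp
  · rintro (i | i) <;> fin_cases i <;> simp <;> linarith
  · intro t ht i
    fin_cases i
    · have : 1 < Real.cosh (Real.sqrt (δ * (1 - δ)) * t) :=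
        Real.one_lt_cosh.2 (mul_pos hμ ht.1).ne'
      exact this.ne'
    · intro hc
      have hpos : 0 < Real.sqrt ((1 + δ) * (2 + δ)) * t := mul_pos hν ht.1
      have hlt : Real.sqrt ((1 + δ) * (2 + δ)) * t < 2 * Real.pi := by
        nlinarith [Real.pi_gt_three, ht.1, ht.2]
      exact hpos.ne' ((Real.cos_eq_one_iff_of_lt_of_lt (by linarith) hlt).1 hc)
  -- Three positive weights and one negative give signature `2` at time `0`, and half of it is the
  -- index.
  · have e1 : {i | 0 < Sum.elim ![δ, 2 + δ] (-![1 - δ, -(1 + δ)]) i} =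
        {.inl 0, .inl 1, .inr 1} := by
      ext (i | i) <;> fin_cases i <;> simp <;> linarith
    have e2 : {i | Sum.elim ![δ, 2 + δ] (-![1 - δ, -(1 + δ)]) i < 0} = {.inr 0} := by
      ext (i | i) <;> fin_cases i <;> simp <;> linarith
    rw [e1, e2, Set.ncard_singleton, Set.ncard_eq_toFinset_card']
    simp

/-! ### The variational equation along geodesics of type A -/

theorem hasDerivAt_of_coord {f : ℝ → Sol} {f' : Sol} {t : ℝ}
    (h : ∀ i, HasDerivAt (fun s => f s i) (f' i) t) : HasDerivAt f f' t :=
  (PiLp.continuousLinearEquiv 2 ℝ fun _ : Fin 3 => ℝ).symm.hasFDerivAt.comp_hasDerivAt t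
    (hasDerivAt_pi.2 h)

theorem fderiv_geodesicField (w u : Sol × Sol) (hz : w.2 2 = 0) :
    fderiv ℝ geodesicField w u = (u.2, !₂[2 * u.2 2 * w.2 0, -(2 * u.2 2 * w.2 1),
      2 * u.1 2 * (Real.exp (2 * w.1 2) * w.2 1 ^ 2 + Real.exp (-(2 * w.1 2)) * w.2 0 ^ 2) +
      2 * Real.exp (2 * w.1 2) * w.2 1 * u.2 1 -
      2 * Real.exp (-(2 * w.1 2)) * w.2 0 * u.2 0]) := by
  have hd : DifferentiableAt ℝ geodesicField w := by
    refine DifferentiableAt.congr_of_eventuallyEq (differentiableAt_snd.prodMk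
      (differentiableAt_euclidean.2 fun i => ?_)) (Filter.Eventually.of_forall geodesicField_eq)
    have a : ∀ j, DifferentiableAt ℝ (fun w : Sol × Sol => w.1 j) w := fun j => by fun_prop
    have b : ∀ j, DifferentiableAt ℝ (fun w : Sol × Sol => w.2 j) w := fun j => by fun_prop
    fin_cases i
    · exact ((b 2).const_mul 2).mul (b 0)
    · exact (((b 2).const_mul 2).mul (b 1)).neg
    · exact (((a 2).const_mul 2).exp.mul ((b 1).pow 2)).sub
        (((a 2).const_mul 2).neg.exp.mul ((b 0).pow 2))
  have hl : HasDerivAt (fun s : ℝ => w + s • u) u 0 := by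
    simpa using ((hasDerivAt_id (0 : ℝ)).smul_const u).const_add w
  have hc : HasDerivAt (fun s : ℝ => geodesicField (w + s • u)) (fderiv ℝ geodesicField w u) 0 := by
    have hg : HasFDerivAt geodesicField (fderiv ℝ geodesicField w) (w + (0 : ℝ) • u) := by
      simpa using hd.hasFDerivAt
    exact hg.comp_hasDerivAt (0 : ℝ) hl
  refine hc.unique ?_
  simp only [geodesicField_eq]
  have a := (ContinuousLinearMap.fst ℝ Sol Sol).hasFDerivAt.comp_hasDerivAt (0 : ℝ) hl
  have b := (ContinuousLinearMap.snd ℝ Sol Sol).hasFDerivAt.comp_hasDerivAt (0 : ℝ) hl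
  have z := hasDerivAt_coord a 2
  have v := fun i => hasDerivAt_coord b i
  refine HasDerivAt.prodMk b (hasDerivAt_of_coord fun i => ?_)
  fin_cases i
  · refine (((v 2).const_mul 2).mul (v 0)).congr_deriv ?_
    simp [hz]
  · refine (((v 2).const_mul 2).mul (v 1)).neg.congr_deriv ?_
    simp [hz]
  · refine ((((z.const_mul 2).exp.mul ((v 1).pow 2))).sub
      ((z.const_mul 2).neg.exp.mul ((v 0).pow 2))).congr_deriv ?_
    simp
    ring

/-- Along such a geodesic `z`, the velocity and hence the frame are constant in coordinates, so the
variational equation has constant coefficients. The linearized field sends `h₁ ↦ 0`, `h₂ ↦ h₁`, `h₃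
↦ 2 h₄`, `h₄ ↦ -h₃`, which is the block generator. -/
theorem IsTypeA.isLinearizedFlow {γ : ℝ → Sol} (h : IsTypeA γ) :
    IsLinearizedFlow γ typeAFlow := by
  obtain ⟨h, s, r, hs, hr, hv⟩ := h
  have h2 : ∀ t, deriv γ t 2 = 0 := fun t => by rw [hv]; simp [fieldX, fieldY]
  have hz : ∀ t, γ t 2 = γ 0 2 := fun t =>
    is_const_of_deriv_eq_zero (fun t => (hasDerivAt_coord (h.hasDerivAt t) 2).differentiableAt)
      (fun t => ((hasDerivAt_coord (h.hasDerivAt t) 2).deriv).trans (h2 t)) t 0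
  have hvc : ∀ t, deriv γ t = deriv γ 0 := fun t => by
    rw [hv, hv]; simp only [fieldX, fieldY, hz t]
  have hframe : ∀ t, contactFrame (tangentLift γ t) = contactFrame (tangentLift γ 0) := fun t => by
    simp only [contactFrame, tangentLift, fieldZ]; rw [hvc t]
  refine ⟨isBlockSolution_typeA.path_zero, fun j t => ?_⟩
  simp only [hframe]
  have hd : HasDerivAt (fun t => ∑ i, typeAFlow t i j • contactFrame (tangentLift γ 0) i)
      (∑ i, (blockGenerator ![1, -1] ![0, 2] * typeAFlow t) i j • contactFrame (tangentLift γ 0) i)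
      t := HasDerivAt.fun_sum fun i _ =>
    (isBlockSolution_typeA.hasDerivAt_entry t i j).smul_const _
  refine hd.congr_deriv ?_
  have hu := h.unit t
  rw [h2, hvc] at hu
  rw [fderiv_geodesicField _ _ (h2 t)]
  generalize hM : typeAFlow t = M
  simp only [tangentLift, hvc t, Matrix.mul_apply, Fintype.sum_sum_type, Fin.sum_univ_two,
    contactFrame, fieldZ, blockGenerator]
  refine Prod.ext ?_ ?_
  · ext i
    fin_cases i <;> simp <;> ring
  · ext i
    fin_cases i
    · simp; ring
    · simp; ring
    · simp
      -- Unit speed is needed only for the `Z`-component of the image of `h₃`.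
      linear_combination 2 * M (.inl 1) j * hu

theorem IsTypeA.hasMorseBottIndex {γ : ℝ → Sol} (h : IsTypeA γ) {T : ℝ} (hT : 0 < T) (hT1 : T ≤ 1) :
    HasMorseBottIndex γ T 1 :=
  ⟨typeAFlow, h.isLinearizedFlow, hasBottIndex_typeAFlow hT hT1⟩

/-! ### The metric of a quotient of Sol -/

/-- The pullback of the Sol metric at `q` by a linear map `A`. -/
def pullbackForm (q : Sol) (A : Sol →L[ℝ] Sol) : Sol →L[ℝ] Sol →L[ℝ] ℝ :=
  ∑ i, (solGram q i i • ((EuclideanSpace.proj i : Sol →L[ℝ] ℝ) ∘L A)).smulRight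
    ((EuclideanSpace.proj i : Sol →L[ℝ] ℝ) ∘L A)

theorem pullbackForm_apply (q : Sol) (A : Sol →L[ℝ] Sol) (v w : Sol) :
    pullbackForm q A v w = solMetric q (A v) (A w) := by
  rw [solMetric_eq]
  simp [pullbackForm, Fin.sum_univ_three, solGram]

theorem contDiff_pullbackForm :
    ContDiff ℝ ∞ fun a : Sol × (Sol →L[ℝ] Sol) => pullbackForm a.1 a.2 := by
  have hc : ∀ i, ContDiff ℝ ∞ fun a : Sol × (Sol →L[ℝ] Sol) =>
      (EuclideanSpace.proj i : Sol →L[ℝ] ℝ) ∘L a.2 := fun i =>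
    contDiff_const.clm_comp contDiff_snd
  have hg : ∀ i, ContDiff ℝ ∞ fun a : Sol × (Sol →L[ℝ] Sol) => solGram a.1 i i := by
    intro i
    fin_cases i <;> simp [solGram] <;> fun_prop
  exact ContDiff.sum fun i _ => ((hg i).smul (hc i)).smulRight (hc i)

theorem solMetric_symm (q v w : Sol) : solMetric q v w = solMetric q w v := by
  rw [solMetric_eq, solMetric_eq]; ring

theorem solMetric_pos (q : Sol) {v : Sol} (hv : v ≠ 0) : 0 < solMetric q v v := by
  rw [solMetric_eq]
  by_contra hle
  have h0 : 0 ≤ Real.exp (-(2 * q 2)) * v 0 ^ 2 := by positivity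
  have h1 : 0 ≤ Real.exp (2 * q 2) * v 1 ^ 2 := by positivity
  have e0 : Real.exp (-(2 * q 2)) * v 0 ^ 2 = 0 := by nlinarith [sq_nonneg (v 2)]
  have e1 : Real.exp (2 * q 2) * v 1 ^ 2 = 0 := by nlinarith [sq_nonneg (v 2)]
  have e2 : v 2 ^ 2 = 0 := by nlinarith [sq_nonneg (v 2)]
  simp at e0 e1 e2
  exact hv (by ext i; fin_cases i <;> simp [e0, e1, e2])

theorem isVonNBounded_solMetric (q : Sol) :
    Bornology.IsVonNBounded ℝ {v : Sol | solMetric q v v < 1} := by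
  rw [NormedSpace.isVonNBounded_iff, isBounded_iff_forall_norm_le]
  refine ⟨Real.sqrt (Real.exp (2 * q 2) + Real.exp (-(2 * q 2)) + 1), fun v hv => ?_⟩
  change solMetric q v v < 1 at hv
  rw [solMetric_eq] at hv
  rw [EuclideanSpace.norm_eq]
  refine Real.sqrt_le_sqrt ?_
  have e1 : Real.exp (-(2 * q 2)) * Real.exp (2 * q 2) = 1 := by rw [← Real.exp_add]; simp
  set a := Real.exp (-(2 * q 2))
  set b := Real.exp (2 * q 2)
  have ha : 0 < a := Real.exp_pos _
  have hb : 0 < b := Real.exp_pos _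
  have h0 : 0 ≤ a * v 0 ^ 2 := by positivity
  have h1 : 0 ≤ b * v 1 ^ 2 := by positivity
  have h2 := sq_nonneg (v 2)
  have i0 : v 0 ^ 2 ≤ b := by
    calc v 0 ^ 2 = b * (a * v 0 ^ 2) := by linear_combination (-v 0 ^ 2) * e1
      _ ≤ b * 1 := by gcongr; nlinarith
      _ = b := mul_one b
  have i1 : v 1 ^ 2 ≤ a := by
    calc v 1 ^ 2 = a * (b * v 1 ^ 2) := by linear_combination (-v 1 ^ 2) * e1
      _ ≤ a * 1 := by gcongr; nlinarith
      _ = a := mul_one a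
  simp [Fin.sum_univ_three]
  nlinarith

/-! ### Local sections and descent of the metric -/

section

variable {L : Type*} [TopologicalSpace L] [ChartedSpace (EuclideanSpace ℝ (Fin 3)) L]
  {Λ : Subgroup (Equiv.Perm Sol)} {π : Sol → L}

theorem IsSolQuotient.apply_mem (h : IsSolQuotient Λ π) {l : Equiv.Perm Sol} (hl : l ∈ Λ) (p : Sol) :
    π (l p) = π p :=
  ((h.fibers p (l p)).2 ⟨l, hl, rfl⟩).symm

/-- The differential at `x` of a map to Sol. -/
def dSol (σ : L → Sol) (x : L) : Sol →L[ℝ] Sol := mfderiv (𝓡 3) (𝓡 3) σ x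

/-- The differential of a map from Sol. -/
def dProj (π : Sol → L) (p : Sol) : Sol →L[ℝ] Sol := mfderiv (𝓡 3) (𝓡 3) π p

/-- `σ` is a section of `π` near `x`, differentiable at `x`. -/
def IsLocalSection (π : Sol → L) (σ : L → Sol) (x : L) : Prop :=
  MDifferentiableAt (𝓡 3) (𝓡 3) σ x ∧ ∀ᶠ y in nhds x, π (σ y) = y

theorem IsSolQuotient.mdifferentiableAt (h : IsSolQuotient Λ π) (p : Sol) :
    MDifferentiableAt (𝓡 3) (𝓡 3) π p :=
  h.localDiffeo.mdifferentiable (by simp) p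

theorem IsSolQuotient.dProj_injective (h : IsSolQuotient Λ π) (p : Sol) :
    Function.Injective (dProj π p) :=
  (h.localDiffeo.mfderivToContinuousLinearEquiv (by simp) p).injective

theorem IsLocalSection.dProj_dSol {σ : L → Sol} {x : L} (hσ : IsLocalSection π σ x)
    (h : IsSolQuotient Λ π) (v : Sol) : dProj π (σ x) (dSol σ x v) = v := by
  have h1 := mfderiv_comp (I := 𝓡 3) (I' := 𝓡 3) (I'' := 𝓡 3) x (h.mdifferentiableAt (σ x)) hσ.1
  have h2 : mfderiv (𝓡 3) (𝓡 3) (π ∘ σ) x = mfderiv (𝓡 3) (𝓡 3) id x :=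
    Filter.EventuallyEq.mfderiv_eq hσ.2
  rw [mfderiv_id] at h2
  exact congrArg (fun A : Sol →L[ℝ] Sol => A v) (h1.symm.trans h2)

theorem IsLocalSection.dSol_dProj {σ : L → Sol} {p : Sol} (hσ : IsLocalSection π σ (π p))
    (hp : σ (π p) = p) (h : IsSolQuotient Λ π) (v : Sol) :
    dSol σ (π p) (dProj π p v) = v := by
  refine h.dProj_injective p ?_
  have := hσ.dProj_dSol h (dProj π p v)
  rwa [hp] at this

/-- Two local sections of a quotient by isometries induce the same metric. -/
theorem IsLocalSection.solMetric_eq {σ τ : L → Sol} {x : L} (hσ : IsLocalSection π σ x)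
    (hτ : IsLocalSection π τ x) (h : IsSolQuotient Λ π) (v w : Sol) :
    solMetric (σ x) (dSol σ x v) (dSol σ x w) = solMetric (τ x) (dSol τ x v) (dSol τ x w) := by
  obtain ⟨l, hl, hlx⟩ := (h.fibers (σ x) (τ x)).1 (hσ.2.self_of_nhds.trans hτ.2.self_of_nhds.symm)
  have hli := h.isometry l hl
  have hld : MDifferentiableAt (𝓡 3) (𝓡 3) l (σ x) :=
    (hli.1.differentiable (by simp) (σ x)).mdifferentiableAt
  have hls : IsLocalSection π (l ∘ σ) x :=
    ⟨hld.comp x hσ.1, hσ.2.mono fun y hy => (h.apply_mem hl _).trans hy⟩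
  have hd : ∀ u, dSol (l ∘ σ) x u = fderiv ℝ l (σ x) (dSol σ x u) := by
    intro u
    have := mfderiv_comp (I := 𝓡 3) (I' := 𝓡 3) (I'' := 𝓡 3) x hld hσ.1
    rw [mfderiv_eq_fderiv] at this
    exact congrArg (fun A : Sol →L[ℝ] Sol => A u) this
  have he : ∀ u, dSol τ x u = fderiv ℝ l (σ x) (dSol σ x u) := by
    intro u
    refine h.dProj_injective (τ x) ?_
    rw [hτ.dProj_dSol h, ← hd, ← hlx]
    exact (hls.dProj_dSol h u).symm
  rw [he, he, ← hlx, hli.2.2]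

theorem IsSolQuotient.exists_localSection (h : IsSolQuotient Λ π) (p : Sol) :
    ∃ σ : L → Sol, σ (π p) = p ∧ ContMDiffAt (𝓡 3) (𝓡 3) ∞ σ (π p) ∧
      ∀ᶠ x in nhds (π p), IsLocalSection π σ x := by
  have hp := h.localDiffeo p
  refine ⟨hp.localInverse, hp.localInverse_left_inv hp.localInverse_mem_target,
    hp.localInverse_contMDiffAt, ?_⟩
  filter_upwards [hp.localInverse_open_source.mem_nhds hp.localInverse_mem_source] with x hx
  have hn := hp.localInverse_open_source.mem_nhds hx
  refine ⟨(hp.localInverse_contMDiffOn.contMDiffAt hn).mdifferentiableAt (by simp), ?_⟩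
  filter_upwards [hn] with y hy
  exact hp.localInverse_right_inv hy

theorem IsSolQuotient.exists_isLocalSection (h : IsSolQuotient Λ π) (x : L) :
    ∃ σ : L → Sol, IsLocalSection π σ x := by
  obtain ⟨p, rfl⟩ := h.surjective x
  obtain ⟨σ, -, -, hσ⟩ := h.exists_localSection p
  exact ⟨σ, hσ.self_of_nhds⟩

/-- The quotient metric on the tangent space at `x`. -/
def quotientForm (h : IsSolQuotient Λ π) (x : L) :
    TangentSpace (𝓡 3) x →L[ℝ] TangentSpace (𝓡 3) x →L[ℝ] ℝ :=
  pullbackForm ((h.exists_isLocalSection x).choose x) (dSol (h.exists_isLocalSection x).choose x)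

/-- The section in `quotientForm` is chosen separately at each point; independence of this choice
allows one section to be used on a whole neighbourhood. -/
theorem quotientForm_apply (h : IsSolQuotient Λ π) {x : L} {τ : L → Sol}
    (hτ : IsLocalSection π τ x) (v w : TangentSpace (𝓡 3) x) :
    quotientForm h x v w = solMetric (τ x) (dSol τ x v) (dSol τ x w) :=
  (pullbackForm_apply _ _ v w).trans
    ((h.exists_isLocalSection x).choose_spec.solMetric_eq hτ h v w)

theorem quotientForm_dProj (h : IsSolQuotient Λ π) (p v w : Sol) :
    quotientForm h (π p) (dProj π p v) (dProj π p w) = solMetric p v w := by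
  obtain ⟨σ, hσp, -, hσ⟩ := h.exists_localSection p
  have hσ := hσ.self_of_nhds
  refine (quotientForm_apply h hσ (dProj π p v) (dProj π p w)).trans ?_
  rw [hσ.dSol_dProj hσp h, hσ.dSol_dProj hσp h, hσp]

variable [IsManifold (𝓡 3) ∞ L]

/-- Near a point the form is the pullback of the Sol metric by one smooth local section, a smooth
function of its value and differential. The rest matches this with the trivializations of the bundle
of bilinear forms. -/
theorem contMDiff_quotientForm (h : IsSolQuotient Λ π) :
    ContMDiff (𝓡 3) ((𝓡 3).prod 𝓘(ℝ, EuclideanSpace ℝ (Fin 3) →L[ℝ] EuclideanSpace ℝ (Fin 3) →L[ℝ] ℝ)) ∞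
      (fun x : L => Bundle.TotalSpace.mk' (EuclideanSpace ℝ (Fin 3) →L[ℝ] EuclideanSpace ℝ (Fin 3) →L[ℝ] ℝ)
        (E := fun x : L => TangentSpace (𝓡 3) x →L[ℝ] TangentSpace (𝓡 3) x →L[ℝ] ℝ) x
        (quotientForm h x)) := by
  intro x₀
  obtain ⟨p, rfl⟩ := h.surjective x₀
  obtain ⟨σ, hσp, hσs, hσ⟩ := h.exists_localSection p
  rw [contMDiffAt_hom_bundle]
  refine ⟨contMDiffAt_id, ?_⟩
  have hD := hσs.mfderiv_const (m := ∞) (by exact right_eq_inf.mp rfl)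
  have hG := contDiff_pullbackForm.contMDiff.contMDiffAt.comp (π p) (hσs.prodMk_space hD)
  refine hG.congr_of_eventuallyEq ?_
  have hb : ∀ᶠ x in nhds (π p), x ∈
      (trivializationAt (EuclideanSpace ℝ (Fin 3)) (TangentSpace (𝓡 3)) (π p)).baseSet :=
    (trivializationAt (EuclideanSpace ℝ (Fin 3)) (TangentSpace (𝓡 3)) (π p)).open_baseSet.mem_nhds
      (FiberBundle.mem_baseSet_trivializationAt' _)
  filter_upwards [hσ, hb] with x hx hxb
  ext v w
  refine (inCoordinates_apply_eq₂ (F₃ := ℝ) (E₃ := Bundle.Trivial L ℝ) (ϕ := quotientForm h x)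
    hxb hxb (by trivial)).trans ?_
  rw [quotientForm_apply h hx]
  simp only [Function.comp, pullbackForm_apply]
  have key : ∀ u : EuclideanSpace ℝ (Fin 3),
      inTangentCoordinates (𝓡 3) (𝓡 3) id σ (fun x => mfderiv (𝓡 3) (𝓡 3) σ x) (π p) x u =
      dSol σ x ((trivializationAt (EuclideanSpace ℝ (Fin 3)) (TangentSpace (𝓡 3)) (π p)).symm x u) := by
    intro u
    simp only [inTangentCoordinates, ContinuousLinearMap.inCoordinates, id,
      TangentBundle.continuousLinearMapAt_model_space]
    exact congrArg (dSol σ x) (Bundle.Trivialization.symmL_apply _ hxb u)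
  have hid : ∀ r : ℝ, (trivializationAt ℝ (Bundle.Trivial L ℝ) (π p)).linearMapAt ℝ x r = r := by
    intro r
    simp
  refine (hid _).trans ?_
  rw [key, key]

/-- The quotient metric of a quotient of Sol. -/
def quotientMetric (h : IsSolQuotient Λ π) : SmoothMetric L where
  inner := quotientForm h
  symm x v w := by
    obtain ⟨σ, hσ⟩ := h.exists_isLocalSection x
    rw [quotientForm_apply h hσ, quotientForm_apply h hσ, solMetric_symm]
  pos x v hv := by
    obtain ⟨σ, hσ⟩ := h.exists_isLocalSection x
    rw [quotientForm_apply h hσ]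
    refine solMetric_pos _ fun h0 => hv ?_
    rw [← hσ.dProj_dSol h v, h0, map_zero]
    rfl
  isVonNBounded x := by
    obtain ⟨σ, hσ⟩ := h.exists_isLocalSection x
    refine ((isVonNBounded_solMetric (σ x)).image (dProj π (σ x))).subset fun v hv => ?_
    refine ⟨dSol σ x v, ?_, hσ.dProj_dSol h v⟩
    have := quotientForm_apply h hσ v v
    exact this.symm.trans_lt hv
  contMDiff := contMDiff_quotientForm h

theorem isSolMetric_quotientMetric (h : IsSolQuotient Λ π) :
    IsSolMetric (quotientMetric h) Λ π :=
  ⟨h, fun p v w => quotientForm_dProj h p v w⟩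

end

/-! ### Dilating a quotient of Sol -/

/-- The dilation as a diffeomorphism. -/
def dilationDiffeo (r : ℝ) (hr : r ≠ 0) : Diffeomorph (𝓡 3) (𝓡 3) Sol Sol ∞ where
  toEquiv := dilation r hr
  contMDiff_toFun := (contDiff_dilation r hr).contMDiff
  contMDiff_invFun := (contDiff_dilation_symm r hr).contMDiff

theorem continuous_dilation_inv (r : ℝ) (hr : r ≠ 0) : Continuous ⇑(dilation r hr)⁻¹ :=
  (contDiff_dilation_symm r hr).continuous

section

variable {L : Type*} [TopologicalSpace L] [ChartedSpace (EuclideanSpace ℝ (Fin 3)) L]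
  {Λ : Subgroup (Equiv.Perm Sol)} {π : Sol → L}

/-- Everything except the isometry condition is transported by the diffeomorphism; that condition
holds because dilations normalize the isometry group. -/
theorem IsSolQuotient.dilate (h : IsSolQuotient Λ π) (r : ℝ) (hr : r ≠ 0) :
    IsSolQuotient (Λ.map (MulAut.conj (dilation r hr)).toMonoidHom) (π ∘ ⇑(dilation r hr)⁻¹) := by
  have hmem : ∀ l ∈ Λ.map (MulAut.conj (dilation r hr)).toMonoidHom,
      ∃ k ∈ Λ, dilation r hr * k * (dilation r hr)⁻¹ = l := fun l hl => hl
  have hcont := continuous_dilation_inv r hr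
  refine ⟨fun l hl => ?_, ⟨fun {K K'} hK hK' => ?_⟩, fun l hl p hp => ?_, fun p => ?_, ?_,
    fun p q => ?_⟩
  · obtain ⟨k, hk, rfl⟩ := hmem l hl
    exact (h.isometry k hk).dilation_conj r hr
  · have hfin := h.discrete.finite_disjoint_inter_image (hK.image hcont) (hK'.image hcont)
    let f : Λ.map (MulAut.conj (dilation r hr)).toMonoidHom → Λ := fun l =>
      ⟨(dilation r hr)⁻¹ * l * dilation r hr, by
        obtain ⟨k, hk, e⟩ := hmem l l.2
        rw [← e]
        simpa [mul_assoc] using hk⟩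
    have hf : Function.Injective f := by
      intro l l' e
      have := congrArg Subtype.val e
      exact Subtype.ext (mul_left_cancel (mul_right_cancel this))
    refine (hfin.preimage hf.injOn).subset ?_
    rintro l ⟨_, ⟨p, hp, rfl⟩, hp'⟩
    refine ⟨(dilation r hr)⁻¹ ((l : Equiv.Perm Sol) p), ⟨(dilation r hr)⁻¹ p, ⟨p, hp, rfl⟩, ?_⟩,
      ⟨_, hp', rfl⟩⟩
    change ((dilation r hr)⁻¹ * l * dilation r hr) ((dilation r hr)⁻¹ p) = _
    simp
  · obtain ⟨k, hk, rfl⟩ := hmem l hl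
    have : k ((dilation r hr)⁻¹ p) = (dilation r hr)⁻¹ p := by
      rw [Equiv.Perm.eq_inv_iff_eq]
      exact hp
    rw [h.free k hk _ this, mul_one, mul_inv_cancel]
  · exact ((dilationDiffeo r hr).symm.isLocalDiffeomorph p).comp (𝓡 3) L (h.localDiffeo _)
  · exact h.surjective.comp (dilation r hr)⁻¹.surjective
  · rw [Function.comp_apply, Function.comp_apply, h.fibers]
    constructor
    · rintro ⟨k, hk, e⟩
      refine ⟨_, ⟨k, hk, rfl⟩, ?_⟩
      change dilation r hr (k ((dilation r hr)⁻¹ p)) = q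
      rw [e]
      exact (dilation r hr).apply_symm_apply q
    · rintro ⟨l, hl, rfl⟩
      obtain ⟨k, hk, rfl⟩ := hmem l hl
      refine ⟨k, hk, ?_⟩
      simp

/-- The squares of the deck transformations closing up the loops in a given class which are
horizontal translations have a bounded invariant. -/
theorem IsSolQuotient.exists_bound (h : IsSolQuotient Λ π) (c : HomotopyClass L) :
    ∃ M : ℝ, ∀ l, IsDeckOf Λ π c l → ∀ a b, IsHorizontal ⇑(l * l) a b → |a * b| ≤ M := by
  -- One such transformation fixes the bound, the others being conjugate to it; if there is none,
  -- any constant works.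
  by_cases hex : ∃ l a b, IsDeckOf Λ π c l ∧ IsHorizontal ⇑(l * l) a b
  · obtain ⟨l, a, b, hl, hab⟩ := hex
    refine ⟨|a * b|, fun l' hl' a' b' hab' => ?_⟩
    obtain ⟨d, hd, rfl⟩ := h.exists_conj_of_isDeckOf hl hl'
    exact ((h.isometry d hd).abs_mul_eq_of_conj (by group) hab hab').ge
  · exact ⟨0, fun l hl a b hab => (hex ⟨l, a, b, hl, hab⟩).elim⟩

/-- A geodesic of the dilated quotient which closes up in a given class is closed up by an isometry
whose square, if it is a horizontal translation, is small. -/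
theorem IsSolQuotient.exists_closing (h : IsSolQuotient Λ π) {r : ℝ} (hr : r ≠ 0)
    {c : HomotopyClass L} {M : ℝ}
    (hM : ∀ l, IsDeckOf Λ π c l → ∀ a b, IsHorizontal ⇑(l * l) a b → |a * b| ≤ M) {γ : ℝ → Sol}
    (hγ : Continuous γ) {T : ℝ} (hc : Realizes (fun t => (π ∘ ⇑(dilation r hr)⁻¹) (γ t)) T c) :
    ∃ φ : Sol → Sol, IsStraight φ ∧ (∀ t, γ (t + 2 * T) = φ (γ t)) ∧
      ∀ a b, IsHorizontal φ a b → |a * b| ≤ r ^ 2 * M := by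
  obtain ⟨l, hl, hlt⟩ := h.exists_isDeckOf ((continuous_dilation_inv r hr).comp hγ) hc
  obtain ⟨φ, hφ⟩ : ∃ φ, φ = dilation r hr * l * (dilation r hr)⁻¹ := ⟨_, rfl⟩
  have hφt : ∀ t, γ (t + T) = φ (γ t) := by
    intro t
    have := hlt t
    simp only [Function.comp] at this
    rw [hφ, Equiv.Perm.mul_apply, Equiv.Perm.mul_apply, ← this]
    exact ((dilation r hr).apply_symm_apply _).symm
  have hφi : IsSolIsometry φ := hφ ▸ (h.isometry l hl.1).dilation_conj r hr
  refine ⟨⇑(φ * φ), hφi.isStraight_mul_self, fun t => ?_, fun a b hab => ?_⟩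
  · rw [two_mul, ← add_assoc, hφt, hφt]
    rfl
  -- Undoing the dilation divides both translation components by `r`, hence `|a b|` by `r²`.
  · have hll : IsHorizontal ⇑(l * l) (r⁻¹ * a) (r⁻¹ * b) := by
      intro p
      have e : l * l = (dilation r hr)⁻¹ * (φ * φ) * dilation r hr := by rw [hφ]; group
      rw [e, Equiv.Perm.mul_apply, Equiv.Perm.mul_apply, hab, dilation_inv_apply, dilation_apply]
      ext i
      fin_cases i <;> simp <;> field_simp
    have := hM l hl _ _ hll
    rw [show r⁻¹ * a * (r⁻¹ * b) = (r ^ 2)⁻¹ * (a * b) by field_simp, abs_mul,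
      abs_of_pos (by positivity), inv_mul_le_iff₀ (by positivity)] at this
    exact this

end

end SolGeometry

end

/-! ### Choice of the dilation factor and conclusion -/

theorem mainTheorem5 (L : Type*) [TopologicalSpace L] [T2Space L] [CompactSpace L]
    [ChartedSpace (EuclideanSpace ℝ (Fin 3)) L] [IsManifold (𝓡 3) ∞ L]
    (hL : SolGeometry.IsSolManifold L)
    (S : Set (SolGeometry.HomotopyClass L)) (hS : S.Finite) :
    ∃ (g : SolGeometry.SmoothMetric L) (Λ : Subgroup (Equiv.Perm SolGeometry.Sol))
      (π : SolGeometry.Sol → L),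
      SolGeometry.IsSolMetric g Λ π ∧
      (∀ c ∈ S, ¬ ∃ (γ : ℝ → SolGeometry.Sol) (T : ℝ),
        SolGeometry.IsTypeC γ ∧ SolGeometry.Realizes (fun t => π (γ t)) T c) ∧
      (∀ c ∈ S, ∀ (γ : ℝ → SolGeometry.Sol) (T : ℝ),
        SolGeometry.IsTypeA γ → SolGeometry.Realizes (fun t => π (γ t)) T c →
          SolGeometry.HasMorseBottIndex γ T 1) := by
  obtain ⟨Λ, π, h⟩ := hL
  choose M hM using h.exists_bound
  obtain ⟨B, hB⟩ := (hS.image M).bddAbove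
  have hMB : ∀ c ∈ S, M c ≤ B := fun c hc => hB ⟨c, hc, rfl⟩
  -- Any constant below `1/8` excludes type C, and `1/16` is far below what the bound `T ≤ 1`
  -- requires. The maximum with `1` keeps `r` well defined when `B` is not positive.
  obtain ⟨r, hr, hrB⟩ : ∃ r : ℝ, r ≠ 0 ∧ r ^ 2 * B ≤ 1 / 16 := by
    have hpos : 0 < max B 1 := lt_max_of_lt_right one_pos
    refine ⟨(4 * max B 1)⁻¹, by positivity, ?_⟩
    calc (4 * max B 1)⁻¹ ^ 2 * B ≤ (4 * max B 1)⁻¹ ^ 2 * max B 1 := by gcongr; exact le_max_left _ _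
      _ = (max B 1)⁻¹ * (1 / 16) := by field_simp; norm_num
      _ ≤ 1 * (1 / 16) := by gcongr; exact inv_le_one_of_one_le₀ (le_max_right _ _)
      _ = 1 / 16 := one_mul _
  have key : ∀ c ∈ S, r ^ 2 * M c ≤ 1 / 16 := fun c hc =>
    (mul_le_mul_of_nonneg_left (hMB c hc) (sq_nonneg r)).trans hrB
  have hq := h.dilate r hr
  refine ⟨SolGeometry.quotientMetric hq, _, _, SolGeometry.isSolMetric_quotientMetric hq, ?_, ?_⟩
  · rintro c hc ⟨γ, T, hγ, hcl⟩
    obtain ⟨φ, hφ, hT, hbound⟩ := h.exists_closing hr (hM c) hγ.1.continuous hcl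
    obtain ⟨a, b, hab, hle⟩ := hγ.le_abs_mul hφ (by linarith [hcl.1]) hT
    linarith [hbound a b hab, key c hc]
  · intro c hc γ T hγ hcl
    obtain ⟨φ, hφ, hT, hbound⟩ := h.exists_closing hr (hM c) hγ.1.continuous hcl
    obtain ⟨a, b, hab, hle⟩ := hγ.abs_mul_eq hφ hT
    refine hγ.hasMorseBottIndex hcl.1 ?_
    have := hbound a b hab
    -- The translation closes up the doubled period, so `(2T)² / 2 ≤ 1/16`, which implies `T ≤ 1`.
    nlinarith [key c hc, hcl.1]
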